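/- Let $n>1$ and let $D$ be the Auslander algebra of $\mathbb{C}[t]/(t^n)$, that is, the path algebra over $\mathbb{C}$ of the quiver with vertices $0,1,\dots,n-1$ and arrows $a_i\colon i\to i-1$, $b_i\colon i-1\to i$ $(1\le i\le n-1)$, modulo the relations $b_{n-1}a_{n-1}=0$ and $a_ib_i=b_{i-1}a_{i-1}$ for $2\le i\le n-1$ (paths are composed from right to left, and modules are left modules). Let $D_0=De_0$ be the indecomposable projective module at the vertex $0$, let $\Delta\subseteq D$ be the subalgebra generated by the trivial paths and the arrows $a_i$, and let $\Delta_i=\Delta e_{i-1}$ for $1\le i\le n$. For $I\subseteq[n]=\{1,\dots,n\}$ let $M_I$ be the unique submodule of $D_0$ with $\Delta$-support $I$, i.e. whose restriction to $\Delta$ is isomorphic to a direct sum of modules $\Delta_i$ in which exactly the indices $i\in I$ occur. Explicitly, $M_I$ is generated by the elements $b_j\cdots b_1\,t^{k_j}$, $0\le j<n$, where $t=a_1b_1$ (acting at the vertex $0$, with $t^0=e_0$) and $k_j=|\{j+1,\dots,n\}\setminus I|$. For sets of integers write $A<B$ if $a<b$ for all $a\in A$, $b\in B$. Subsets $I,J\subseteq[n]$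 are weakly separated if (i) $|I|\ge|J|$ and $J\setminus I$ is a disjoint union $J'\cup J''$ with $J'<(I\setminus J)<J''$, or (ii) $|J|\ge|I|$ and $I\setminus J$ is a disjoint union $I'\cup I''$ with $I'<(J\setminus I)<I''$. For such $I,J$ the Leclerc–Zelevinsky exponent is $c(I,J)=|J''|-|J'|$ in case (i) and $c(I,J)=|I'|-|I''|$ in case (ii) (the two values agree if both cases hold). Theorem. Let $I,J\subseteq[n]$ be weakly separated with $|I|\ge|J|$ and $J\setminus I=J'\cup J''$, where $J'<(I\setminus J)<J''$. Then 1. $\dim_{\mathbb{C}}\operatorname{Hom}_D(M_I,M_J)=|I\cap J|+|J''|$; 2. $\dim_{\mathbb{C}}\operatorname{Hom}_D(M_J,M_I)=|I\cap J|+|J'|$; 3. $\dim_{\mathbb{C}}\operatorname{Ext}^1_D(M_I,M_J)=|J''|$; 4. $\dim_{\mathbb{C}}\operatorname{Ext}^1_D(M_J,M_I)=|J'|$. Consequently $$c(I,J)=\dim\operatorname{Hom}_D(M_I,M_J)-\dim\operatorname{Hom}_D(M_J,M_I)=\dim\operatorname{Ext}^1_D(M_I,M_J)-\dim\operatorname{Ext}^1_D(M_J,M_I).$$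 -/

import Mathlib

open scoped Finset

/-- Generators of the Auslander algebra: the trivial paths `e i` and the arrows
`a i : i ⟶ i - 1` and `b i : i - 1 ⟶ i` (those that exist, see `AuslanderRel`). -/
inductive AuslanderGen : Type
  | e (i : ℕ) : AuslanderGen
  | a (i : ℕ) : AuslanderGen
  | b (i : ℕ) : AuslanderGen

namespace AuslanderGen

/-- The trivial path at the vertex `i`, in the free algebra. -/
noncomputable abbrev E (i : ℕ) : FreeAlgebra ℂ AuslanderGen := FreeAlgebra.ι ℂ (e i)
/-- The arrow `i ⟶ i - 1`, in the free algebra. -/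
noncomputable abbrev A (i : ℕ) : FreeAlgebra ℂ AuslanderGen := FreeAlgebra.ι ℂ (a i)
/-- The arrow `i - 1 ⟶ i`, in the free algebra. -/
noncomputable abbrev B (i : ℕ) : FreeAlgebra ℂ AuslanderGen := FreeAlgebra.ι ℂ (b i)

end AuslanderGen

open AuslanderGen in
/-- The defining relations of the Auslander algebra of `ℂ[t]/(t^n)`. The quiver has the vertices
`0, …, n - 1` and the arrows `a i : i ⟶ i - 1`, `b i : i - 1 ⟶ i` for `1 ≤ i ≤ n - 1`. Paths are
composed from right to left, like maps. All constructors but the last two present the path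
algebra of this quiver; the last two are the relations imposed on it. -/
inductive AuslanderRel (n : ℕ) : FreeAlgebra ℂ AuslanderGen → FreeAlgebra ℂ AuslanderGen → Prop
  | e_out (i : ℕ) (h : n ≤ i) : AuslanderRel n (E i) 0
  | a_out (i : ℕ) (h : ¬ (1 ≤ i ∧ i ≤ n - 1)) : AuslanderRel n (A i) 0
  | b_out (i : ℕ) (h : ¬ (1 ≤ i ∧ i ≤ n - 1)) : AuslanderRel n (B i) 0
  | e_idem (i : ℕ) : AuslanderRel n (E i * E i) (E i)
  | e_orth (i j : ℕ) (h : i ≠ j) : AuslanderRel n (E i * E j) 0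
  | e_sum : AuslanderRel n (∑ i ∈ Finset.range n, E i) 1
  | a_source (i : ℕ) (h : 1 ≤ i ∧ i ≤ n - 1) : AuslanderRel n (A i * E i) (A i)
  | a_target (i : ℕ) (h : 1 ≤ i ∧ i ≤ n - 1) : AuslanderRel n (E (i - 1) * A i) (A i)
  | b_source (i : ℕ) (h : 1 ≤ i ∧ i ≤ n - 1) : AuslanderRel n (B i * E (i - 1)) (B i)
  | b_target (i : ℕ) (h : 1 ≤ i ∧ i ≤ n - 1) : AuslanderRel n (E i * B i) (B i)
  | comm (i : ℕ) (h : 2 ≤ i ∧ i ≤ n - 1) : AuslanderRel n (A i * B i) (B (i - 1) * A (i - 1))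
  | last : AuslanderRel n (B (n - 1) * A (n - 1)) 0

/-- The Auslander algebra `D` of `ℂ[t]/(t^n)`, as the path algebra of a quiver with relations. -/
def AuslanderAlg (n : ℕ) : Type := RingQuot (AuslanderRel n)

namespace AuslanderAlg

noncomputable instance (n : ℕ) : Ring (AuslanderAlg n) :=
  inferInstanceAs (Ring (RingQuot (AuslanderRel n)))

noncomputable instance (n : ℕ) : Algebra ℂ (AuslanderAlg n) :=
  inferInstanceAs (Algebra ℂ (RingQuot (AuslanderRel n)))

variable (n : ℕ)

/-- The quotient map from the free algebra to `D`. -/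
noncomputable def mk : FreeAlgebra ℂ AuslanderGen →ₐ[ℂ] AuslanderAlg n :=
  RingQuot.mkAlgHom ℂ (AuslanderRel n)

/-- The trivial path at the vertex `i`, in `D`. -/
noncomputable def e (i : ℕ) : AuslanderAlg n := mk n (AuslanderGen.E i)
/-- The arrow `i ⟶ i - 1`, in `D`. -/
noncomputable def a (i : ℕ) : AuslanderAlg n := mk n (AuslanderGen.A i)
/-- The arrow `i - 1 ⟶ i`, in `D`. -/
noncomputable def b (i : ℕ) : AuslanderAlg n := mk n (AuslanderGen.B i)
/-- The element `t = a₁ b₁` of `e₀ D e₀`. -/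
noncomputable def t : AuslanderAlg n := a n 1 * b n 1

/-- The path `b_j ⋯ b_1 e_0` from the vertex `0` to the vertex `j`. -/
noncomputable def bPath : ℕ → AuslanderAlg n
  | 0 => e n 0
  | j + 1 => b n (j + 1) * bPath j

/-- The indecomposable projective left module `D_0 = D e_0` at the vertex `0`. -/
noncomputable def D₀ : Submodule (AuslanderAlg n) (AuslanderAlg n) :=
  Submodule.span (AuslanderAlg n) {e n 0}

/-- The rank one module `M_I`, for `I ⊆ {1, …, n}`: the submodule of `D_0` with `Δ`-support `I`
(see `rankOne_le` and `hasDeltaSupport_rankOne`). It is generated by the paths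
`b_j ⋯ b_1 t^k` with `0 ≤ j < n` and `k` the number of elements of `{j + 1, …, n}` outside `I`. -/
noncomputable def rankOne (I : Finset ℕ) : Submodule (AuslanderAlg n) (AuslanderAlg n) :=
  Submodule.span (AuslanderAlg n)
    {x | ∃ j < n, x = bPath n j * t n ^ #(Finset.Icc (j + 1) n \ I)}

/-- The subalgebra `Δ` of `D` generated by the trivial paths and the arrows `a i`; it is the path
algebra of the linear quiver `n - 1 ⟶ ⋯ ⟶ 1 ⟶ 0`. -/
noncomputable def Delta : Subalgebra ℂ (AuslanderAlg n) :=
  Algebra.adjoin ℂ (Set.range (e n) ∪ Set.range (a n))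

/-- The indecomposable projective `Δ`-module `Δ_i = Δ e_{i-1}` of length `i`, for `1 ≤ i ≤ n`. -/
noncomputable def deltaProj (i : ℕ) : Submodule (Delta n) (Delta n) :=
  Submodule.span (Delta n)
    {⟨e n (i - 1), Algebra.subset_adjoin (Or.inl (Set.mem_range_self _))⟩}

/-- The `D`-module `M` is good with `Δ`-support `I`: as a `Δ`-module it is isomorphic to a finite
direct sum of modules `Δ_i` with `1 ≤ i ≤ n`, and the indices `i` that occur form the set `I`. -/
def HasDeltaSupport (M : Type) [AddCommGroup M] [Module (AuslanderAlg n) M] (I : Finset ℕ) :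
    Prop :=
  ∃ (κ : Type) (_ : Fintype κ) (s : κ → ℕ), (∀ k, s k ∈ Finset.Icc 1 n) ∧
    Nonempty (M ≃ₗ[Delta n] ((k : κ) → deltaProj n (s k))) ∧ ∀ i, i ∈ I ↔ ∃ k, s k = i

/-- The module `M_I`, as an object of the category of left `D`-modules. -/
noncomputable abbrev rankOneMod (I : Finset ℕ) : ModuleCat.{0} (AuslanderAlg n) :=
  ModuleCat.of (AuslanderAlg n) (rankOne n I)

end AuslanderAlg

/-- `A < B` for sets of integers: every element of `A` is smaller than every element of `B`. -/
def SetLT (A B : Finset ℕ) : Prop := ∀ x ∈ A, ∀ y ∈ B, x < y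

/-- `|I| ≥ |J|`, and `J \ I` is the disjoint union of `J'` and `J''` with `J' < I \ J < J''`. -/
def IsSeparation (I J J' J'' : Finset ℕ) : Prop :=
  #J ≤ #I ∧ J \ I = J' ∪ J'' ∧ Disjoint J' J'' ∧ SetLT J' (I \ J) ∧ SetLT (I \ J) J''

/-- Weakly separated sets. -/
def WeaklySeparated (I J : Finset ℕ) : Prop :=
  (∃ J' J'', IsSeparation I J J' J'') ∨ (∃ I' I'', IsSeparation J I I' I'')

open Classical in
/-- The Leclerc-Zelevinsky exponent `c(I, J)` of weakly separated sets (and `0` for other sets):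
`|J''| - |J'|` if `|I| ≥ |J|` and `J \ I = J' ∪ J''` with `J' < I \ J < J''`, and `|I'| - |I''|` if
`|J| ≥ |I|` and `I \ J = I' ∪ I''` with `I' < J \ I < I''`. The decomposition is unique. -/
noncomputable def lzExponent (I J : Finset ℕ) : ℤ :=
  if h : ∃ p : Finset ℕ × Finset ℕ, IsSeparation I J p.1 p.2 then
    (#h.choose.2 : ℤ) - #h.choose.1
  else if h : ∃ p : Finset ℕ × Finset ℕ, IsSeparation J I p.1 p.2 then
    (#h.choose.1 : ℤ) - #h.choose.2
  else 0

/- It remains to check that `M_I` is indeed a submodule of `D_0` with `Δ`-support `I`. -/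

namespace AuslanderAlg

variable (n : ℕ)

section
variable {n}

theorem rel {x y : FreeAlgebra ℂ AuslanderGen} (h : AuslanderRel n x y) :
    mk n x = mk n y :=
  RingQuot.mkAlgHom_rel ℂ h

theorem e_out {i : ℕ} (h : n ≤ i) : e n i = 0 := by
  simpa [e] using rel (.e_out i h)
theorem a_out {i : ℕ} (h : ¬ (1 ≤ i ∧ i ≤ n - 1)) : a n i = 0 := by
  simpa [a] using rel (.a_out i h)
theorem b_out {i : ℕ} (h : ¬ (1 ≤ i ∧ i ≤ n - 1)) : b n i = 0 := by
  simpa [b] using rel (.b_out i h)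
theorem e_mul (i j : ℕ) : e n i * e n j = if i = j then e n i else 0 := by
  split_ifs with h
  · subst h; simpa [e] using rel (n := n) (.e_idem i)
  · simpa [e] using rel (n := n) (.e_orth i j h)
theorem a_mul_e (i : ℕ) : a n i * e n i = a n i := by
  by_cases h : 1 ≤ i ∧ i ≤ n - 1
  · simpa [e, a] using rel (.a_source i h)
  · simp [a_out h]
theorem e_mul_a (i : ℕ) : e n (i - 1) * a n i = a n i := by
  by_cases h : 1 ≤ i ∧ i ≤ n - 1
  · simpa [e, a] using rel (.a_target i h)
  · simp [a_out h]
theorem b_mul_e (i : ℕ) : b n i * e n (i - 1) = b n i := by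
  by_cases h : 1 ≤ i ∧ i ≤ n - 1
  · simpa [e, b] using rel (.b_source i h)
  · simp [b_out h]
theorem e_mul_b (i : ℕ) : e n i * b n i = b n i := by
  by_cases h : 1 ≤ i ∧ i ≤ n - 1
  · simpa [e, b] using rel (.b_target i h)
  · simp [b_out h]
theorem comm (i : ℕ) : a n (i + 2) * b n (i + 2) = b n (i + 1) * a n (i + 1) := by
  by_cases h : i + 2 ≤ n - 1
  · simpa [a, b] using rel (.comm (i + 2) ⟨by omega, h⟩)
  · rw [a_out (by omega), zero_mul]
    by_cases h' : i + 1 = n - 1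
    · rw [h']; simpa [a, b] using (rel (n := n) .last).symm
    · rw [a_out (by omega), mul_zero]

theorem adjoin_eq_top :
    Algebra.adjoin ℂ (Set.range (e n) ∪ Set.range (a n) ∪ Set.range (b n)) = ⊤ := by
  have h := congrArg (Subalgebra.map (mk n))
    (FreeAlgebra.adjoin_range_ι (R := ℂ) (X := AuslanderGen))
  rw [AlgHom.map_adjoin, Algebra.map_top,
    (AlgHom.range_eq_top (mk n)).2 (RingQuot.mkAlgHom_surjective ℂ (AuslanderRel n))] at h
  rw [← top_le_iff, ← h]
  apply Algebra.adjoin_mono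
  rintro _ ⟨_, ⟨g, rfl⟩, rfl⟩
  cases g with
  | e i => exact Or.inl (Or.inl ⟨i, rfl⟩)
  | a i => exact Or.inl (Or.inr ⟨i, rfl⟩)
  | b i => exact Or.inr ⟨i, rfl⟩

/-- A complex subspace that is stable under a generating set of a subalgebra is stable under
the subalgebra. -/
theorem stable_of_adjoin {S : Set (AuslanderAlg n)} (W : Submodule ℂ (AuslanderAlg n))
    (h : ∀ s ∈ S, ∀ w ∈ W, s * w ∈ W) {x : AuslanderAlg n} (hx : x ∈ Algebra.adjoin ℂ S) :
    ∀ w ∈ W, x * w ∈ W := by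
  induction hx using Algebra.adjoin_induction with
  | mem s hs => exact h s hs
  | algebraMap r => intro w hw; rw [← Algebra.smul_def]; exact W.smul_mem r hw
  | add x y _ _ hx hy => intro w hw; rw [add_mul]; exact W.add_mem (hx w hw) (hy w hw)
  | mul x y _ _ hx hy => intro w hw; rw [mul_assoc]; exact hx _ (hy w hw)

/-- The element `b_j ⋯ b_1 t^k` of `D_0`. -/
noncomputable def g (n j k : ℕ) : AuslanderAlg n := bPath n j * t n ^ k

theorem bPath_mul_e (j : ℕ) : bPath n j * e n 0 = bPath n j := by
  induction j with
  | zero => simp [bPath, e_mul]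
  | succ j ih => rw [bPath, mul_assoc, ih]

theorem e_mul_bPath (i j : ℕ) : e n i * bPath n j = if i = j then bPath n j else 0 := by
  cases j with
  | zero => simp only [bPath, e_mul]; split_ifs with h <;> simp [h]
  | succ j =>
    rw [bPath, ← mul_assoc, ← e_mul_b (j + 1), ← mul_assoc, e_mul]
    split_ifs with h <;> simp [h]

theorem t_mul_e : t n * e n 0 = t n := by
  rw [t, mul_assoc]; congr 1; exact b_mul_e 1
theorem e_mul_t : e n 0 * t n = t n := by
  rw [t, ← mul_assoc]; congr 1; exact e_mul_a 1

theorem g_mul_e (j k : ℕ) : g n j k * e n 0 = g n j k := by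
  cases k with
  | zero => simp [g, bPath_mul_e]
  | succ k => rw [g, pow_succ, mul_assoc, mul_assoc, t_mul_e]

theorem e_mul_g (i j k : ℕ) : e n i * g n j k = if i = j then g n j k else 0 := by
  rw [g, ← mul_assoc, e_mul_bPath]; split_ifs <;> simp

theorem b_mul_g (i j k : ℕ) : b n i * g n j k = if i = j + 1 then g n i k else 0 := by
  split_ifs with h
  · subst h; rw [g, g, bPath, mul_assoc]
  · by_cases h0 : 1 ≤ i ∧ i ≤ n - 1
    · rw [← b_mul_e, mul_assoc, e_mul_g, if_neg (by omega), mul_zero]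
    · rw [b_out h0, zero_mul]

theorem a_mul_bPath (j : ℕ) : a n (j + 1) * bPath n (j + 1) = bPath n j * t n := by
  induction j with
  | zero => rw [bPath, bPath, ← mul_assoc]; exact t_mul_e.trans e_mul_t.symm
  | succ j ih => rw [bPath, ← mul_assoc, comm, mul_assoc, ih, ← mul_assoc, ← bPath]

theorem a_mul_g (i j k : ℕ) :
    a n i * g n j k = if i = j ∧ 1 ≤ j then g n (j - 1) (k + 1) else 0 := by
  split_ifs with h
  · obtain ⟨rfl, h⟩ := h
    obtain ⟨i, rfl⟩ := Nat.exists_eq_add_of_le' h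
    rw [g, ← mul_assoc, a_mul_bPath, mul_assoc, ← pow_succ', Nat.add_sub_cancel, g]
  · by_cases h0 : 1 ≤ i ∧ i ≤ n - 1
    · rw [← a_mul_e, mul_assoc, e_mul_g, if_neg (by omega), mul_zero]
    · rw [a_out h0, zero_mul]

theorem g_eq_zero {j k : ℕ} (h : n ≤ j + k) : g n j k = 0 := by
  induction k generalizing j with
  | zero =>
    rw [Nat.add_zero] at h
    have := e_mul_g (n := n) j j 0
    rw [e_out h, zero_mul, if_pos rfl] at this
    exact this.symm
  | succ k ih =>
    have := a_mul_g (n := n) (j + 1) (j + 1) k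
    rw [ih (by omega), mul_zero, if_pos ⟨rfl, by omega⟩, Nat.add_sub_cancel] at this
    exact this.symm

end

/-- The pairs `(j, k)` that index the basis `b_j ⋯ b_1 t^k` of `D_0`. -/
abbrev Tri (n : ℕ) : Type := {p : ℕ × ℕ // p.1 + p.2 < n}

/-- Extension by zero of a function on `Tri n`. -/
def ext0 {n : ℕ} (f : Tri n → ℂ) (j k : ℕ) : ℂ := if h : j + k < n then f ⟨(j, k), h⟩ else 0

/-- The action of the generators of `D` on functions on `Tri n`. -/
def genAct (n : ℕ) : AuslanderGen → Module.End ℂ (Tri n → ℂ)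
  | .e i =>
    { toFun := fun f p => if p.1.1 = i then f p else 0
      map_add' := by intros; ext p; dsimp; split_ifs <;> simp
      map_smul' := by intros; ext p; dsimp; split_ifs <;> simp }
  | .a i =>
    { toFun := fun f p => if p.1.1 + 1 = i ∧ 1 ≤ p.1.2 then ext0 f i (p.1.2 - 1) else 0
      map_add' := by intros; ext p; simp only [ext0, Pi.add_apply]; split_ifs <;> simp
      map_smul' := by intros; ext p; simp only [ext0, Pi.smul_apply]; split_ifs <;> simp }
  | .b i =>
    { toFun := fun f p => if p.1.1 = i ∧ 1 ≤ i then ext0 f (i - 1) p.1.2 else 0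
      map_add' := by intros; ext p; simp only [ext0, Pi.add_apply]; split_ifs <;> simp
      map_smul' := by intros; ext p; simp only [ext0, Pi.smul_apply]; split_ifs <;> simp }

theorem genAct_rel (n : ℕ) {x y : FreeAlgebra ℂ AuslanderGen} (h : AuslanderRel n x y) :
    FreeAlgebra.lift ℂ (genAct n) x = FreeAlgebra.lift ℂ (genAct n) y := by
  cases h with
  | e_sum =>
    ext f ⟨⟨j, k⟩, hp⟩
    have hj : j < n := by simp only at hp; omega
    simp [genAct, hj]
  | _ =>
    ext f ⟨⟨j, k⟩, hp⟩
    simp only at hp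
    simp only [AuslanderGen.E, AuslanderGen.A, AuslanderGen.B, map_mul, map_zero,
      FreeAlgebra.lift_ι_apply, Module.End.mul_apply, genAct, LinearMap.coe_mk, AddHom.coe_mk,
      ext0, LinearMap.zero_apply, Pi.zero_apply]
    grind

/-- The action of `D` on functions on `Tri n`. -/
noncomputable def act (n : ℕ) : AuslanderAlg n →ₐ[ℂ] Module.End ℂ (Tri n → ℂ) :=
  RingQuot.liftAlgHom ℂ ⟨FreeAlgebra.lift ℂ (genAct n), fun _ _ h => genAct_rel n h⟩


theorem act_mk (n : ℕ) (x : FreeAlgebra ℂ AuslanderGen) :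
    act n (mk n x) = FreeAlgebra.lift ℂ (genAct n) x :=
  RingQuot.liftAlgHom_mkAlgHom_apply ℂ _ _ _

theorem act_t (n k : ℕ) (q : Tri n) :
    act n (t n ^ k) (fun p => if p.1 = (0, 0) then 1 else 0) q
      = if q.1 = (0, k) then 1 else 0 := by
  have hA : ∀ i, act n (a n i) = genAct n (.a i) := fun i => by simp [act_mk, a]
  have hB : ∀ i, act n (b n i) = genAct n (.b i) := fun i => by simp [act_mk, b]
  induction k generalizing q with
  | zero => simp
  | succ k ih =>
    obtain ⟨⟨x, y⟩, hq⟩ := q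
    simp only at hq
    rw [pow_succ', map_mul, Module.End.mul_apply]
    nth_rw 1 [t]
    rw [map_mul, Module.End.mul_apply, hA, hB]
    rw [show act n (t n ^ k) (fun p => if p.1 = (0, 0) then 1 else 0)
      = fun q => if q.1 = (0, k) then 1 else 0 from funext ih]
    simp only [genAct, LinearMap.coe_mk, AddHom.coe_mk, ext0, Prod.mk.injEq]
    grind

theorem act_g (n j k : ℕ) (q : Tri n) :
    act n (g n j k) (fun p => if p.1 = (0, 0) then 1 else 0) q
      = if q.1 = (j, k) then 1 else 0 := by
  have hB : ∀ i, act n (b n i) = genAct n (.b i) := fun i => by simp [act_mk, b]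
  have hE : ∀ i, act n (e n i) = genAct n (.e i) := fun i => by simp [act_mk, e]
  induction j generalizing q with
  | zero =>
    rw [g, bPath, map_mul, Module.End.mul_apply, hE]
    simp only [genAct, LinearMap.coe_mk, AddHom.coe_mk, act_t]
    obtain ⟨⟨x, y⟩, hq⟩ := q
    simp only [Prod.mk.injEq]
    grind
  | succ j ih =>
    obtain ⟨⟨x, y⟩, hq⟩ := q
    simp only at hq
    rw [g, bPath, mul_assoc, map_mul, Module.End.mul_apply, hB, ← g,
      show act n (g n j k) (fun p => if p.1 = (0, 0) then 1 else 0)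
      = fun q => if q.1 = (j, k) then 1 else 0 from funext ih]
    simp only [genAct, LinearMap.coe_mk, AddHom.coe_mk, ext0, Prod.mk.injEq]
    grind

theorem linearIndependent_g (n : ℕ) :
    LinearIndependent ℂ (fun p : Tri n => g n p.1.1 p.1.2) := by
  apply LinearIndependent.of_comp
    ((LinearMap.applyₗ (fun p : Tri n => if p.1 = (0, 0) then (1 : ℂ) else 0)) ∘ₗ
      (act n).toLinearMap)
  have h : (⇑((LinearMap.applyₗ (fun p : Tri n => if p.1 = (0, 0) then (1 : ℂ) else 0)) ∘ₗ
      (act n).toLinearMap) ∘ fun p : Tri n => g n p.1.1 p.1.2)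
      = fun p : Tri n => (Pi.single p 1 : Tri n → ℂ) := by
    funext p q
    simp only [Function.comp_apply, LinearMap.comp_apply, LinearMap.applyₗ_apply_apply,
      AlgHom.toLinearMap_apply, act_g, Pi.single_apply, Prod.mk.eta, Subtype.ext_iff]
  rw [h]
  exact Pi.linearIndependent_single_one (Tri n) ℂ

section
variable {n}

/-- The trivial path at `i`, in `Δ`. -/
noncomputable def eΔ (n i : ℕ) : Delta n :=
  ⟨e n i, Algebra.subset_adjoin (Or.inl (Set.mem_range_self _))⟩
/-- The arrow `a i`, in `Δ`. -/
noncomputable def aΔ (n i : ℕ) : Delta n :=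
  ⟨a n i, Algebra.subset_adjoin (Or.inr (Set.mem_range_self _))⟩

/-- The path of length `d` with source `i - 1`, in `Δ`. -/
noncomputable def aPath (n i : ℕ) : ℕ → Delta n
  | 0 => eΔ n (i - 1)
  | d + 1 => aΔ n (i - 1 - d) * aPath n i d

theorem aPath_mem (i d : ℕ) : aPath n i d ∈ deltaProj n i := by
  induction d with
  | zero => exact Submodule.subset_span rfl
  | succ d ih => exact Submodule.smul_mem _ (aΔ n (i - 1 - d)) ih

theorem e_mul_aPath (l i d : ℕ) :
    e n l * (aPath n i d : AuslanderAlg n) = if l = i - 1 - d then ↑(aPath n i d) else 0 := by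
  cases d with
  | zero => simp only [aPath, eΔ, e_mul, Nat.sub_zero]; split_ifs with h <;> simp [h]
  | succ d =>
    simp only [aPath, aΔ, MulMemClass.coe_mul]
    rw [← mul_assoc, ← e_mul_a, ← mul_assoc, e_mul, Nat.sub_sub (i - 1) d 1]
    split_ifs with h <;> simp [h]

theorem a_mul_aPath (l i d : ℕ) :
    a n l * (aPath n i d : AuslanderAlg n) =
      if l = i - 1 - d then ↑(aPath n i (d + 1)) else 0 := by
  split_ifs with h
  · subst h; rfl
  · rw [← a_mul_e, mul_assoc, e_mul_aPath, if_neg h, mul_zero]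

theorem aPath_mul_g {i d : ℕ} (k : ℕ) (hd : d < i) :
    (aPath n i d : AuslanderAlg n) * g n (i - 1) k = g n (i - 1 - d) (k + d) := by
  induction d with
  | zero => simp [aPath, eΔ, e_mul_g]
  | succ d ih =>
    simp only [aPath, aΔ, MulMemClass.coe_mul]
    rw [mul_assoc, ih (by omega), a_mul_g, if_pos ⟨rfl, by omega⟩, Nat.sub_sub (i - 1) d 1,
      add_assoc]

theorem exists_coeff {i : ℕ} (hi : 1 ≤ i) (x : deltaProj n i) :
    ∃ c : Fin i → ℂ, ∑ d, c d • (aPath n i d : AuslanderAlg n) = ((x : Delta n) : _) := by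
  rw [← Submodule.mem_span_range_iff_exists_fun]
  obtain ⟨x, hx⟩ := x
  obtain ⟨⟨y, hy⟩, rfl⟩ := Submodule.mem_span_singleton.1 hx
  have h0 : (aPath n i 0 : AuslanderAlg n) ∈
      Submodule.span ℂ (Set.range fun d : Fin i => (aPath n i d : AuslanderAlg n)) :=
    Submodule.subset_span ⟨⟨0, hi⟩, rfl⟩
  refine stable_of_adjoin _ ?_ hy _ h0
  intro s hs w hw
  induction hw using Submodule.span_induction with
  | zero => simp
  | add u v _ _ hu hv => rw [mul_add]; exact add_mem hu hv
  | smul r u _ hu => rw [mul_smul_comm]; exact Submodule.smul_mem _ r hu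
  | mem u hu =>
    obtain ⟨d, rfl⟩ := hu
    rcases hs with ⟨l, rfl⟩ | ⟨l, rfl⟩
    · simp only [e_mul_aPath]
      split_ifs
      · exact Submodule.subset_span ⟨d, rfl⟩
      · exact zero_mem _
    · simp only [a_mul_aPath]
      split_ifs with h
      · by_cases hd : (d : ℕ) + 1 < i
        · exact Submodule.subset_span ⟨⟨d + 1, hd⟩, rfl⟩
        · have : i - 1 - (d : ℕ) = 0 := by omega
          simp only [aPath, aΔ, MulMemClass.coe_mul, this]
          rw [a_out (by omega), zero_mul]
          exact zero_mem _
      · exact zero_mem _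

variable (n) in
theorem card_step (I : Finset ℕ) {i : ℕ} (hi : i ≤ n) :
    #(Finset.Icc i n \ I) = (if i ∈ I then 0 else 1) + #(Finset.Icc (i + 1) n \ I) := by
  have h : Finset.Icc i n = insert i (Finset.Icc (i + 1) n) := by
    ext x; simp only [Finset.mem_Icc, Finset.mem_insert]; omega
  rw [h]
  split_ifs with hI
  · rw [Finset.insert_sdiff_of_mem _ hI, zero_add]
  · rw [Finset.insert_sdiff_of_notMem _ hI, Finset.card_insert_of_notMem (by simp), add_comm]

theorem card_mono (I : Finset ℕ) {i j : ℕ} (hi : i ∈ I) (hij : i < j) (hj : j ≤ n) :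
    i + #(Finset.Icc i n \ I) < j + #(Finset.Icc j n \ I) := by
  induction j, hij using Nat.le_induction with
  | base =>
    have := card_step n I (i := i) (by omega)
    rw [if_pos hi] at this
    simp only [Nat.succ_eq_add_one]
    omega
  | succ j hj' ih =>
    have := card_step n I (i := j) (by omega)
    have := ih (by omega)
    split_ifs at * <;> omega

theorem exists_index (I : Finset ℕ) {j k : ℕ} (hjk : j + k < n)
    (hk : #(Finset.Icc (j + 1) n \ I) ≤ k) :
    ∃ i ∈ I, j < i ∧ i ≤ n ∧ i + #(Finset.Icc i n \ I) = j + 1 + k := by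
  by_contra! H
  have : ∀ i, j + 1 ≤ i → i ≤ n + 1 → i + #(Finset.Icc i n \ I) ≤ j + 1 + k := by
    intro i hi
    induction i, hi using Nat.le_induction with
    | base => intro _; omega
    | succ i hi ih =>
      intro h
      have h1 := card_step n I (i := i) (by omega)
      have h2 := ih (by omega)
      split_ifs at h1 with hI
      · have := H i hI (by omega) (by omega)
        omega
      · omega
  have := this (n + 1) (by omega) le_rfl
  omega

/-- `M_I` is spanned over `ℂ` by basis vectors of `D_0`. -/
theorem rankOne_le_span (I : Finset ℕ) {x : AuslanderAlg n} (hx : x ∈ rankOne n I) :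
    x ∈ Submodule.span ℂ {x | ∃ j k, #(Finset.Icc (j + 1) n \ I) ≤ k ∧ x = g n j k} := by
  induction hx using Submodule.span_induction with
  | mem x hx => obtain ⟨j, _, rfl⟩ := hx; exact Submodule.subset_span ⟨j, _, le_rfl, rfl⟩
  | zero => exact zero_mem _
  | add x y _ _ hx hy => exact add_mem hx hy
  | smul r x _ hx =>
    refine stable_of_adjoin _ ?_ (adjoin_eq_top (n := n) ▸ Algebra.mem_top (x := r)) x hx
    intro s hs w hw
    induction hw using Submodule.span_induction with
    | zero => simp
    | add u v _ _ hu hv => rw [mul_add]; exact add_mem hu hv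
    | smul r u _ hu => rw [mul_smul_comm]; exact Submodule.smul_mem _ r hu
    | mem u hu =>
      obtain ⟨j, k, hk, rfl⟩ := hu
      by_cases hjn : n ≤ j
      · rw [g_eq_zero (by omega), mul_zero]; exact zero_mem _
      rcases hs with (⟨l, rfl⟩ | ⟨l, rfl⟩) | ⟨l, rfl⟩
      · rw [e_mul_g]
        split_ifs
        · exact Submodule.subset_span ⟨j, k, hk, rfl⟩
        · exact zero_mem _
      · rw [a_mul_g]
        split_ifs with h
        · refine Submodule.subset_span ⟨j - 1, k + 1, ?_, rfl⟩
          have := card_step n I (i := j) (by omega)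
          rw [show j - 1 + 1 = j by omega]
          split_ifs at this <;> omega
        · exact zero_mem _
      · rw [b_mul_g]
        split_ifs with h
        · subst h
          refine Submodule.subset_span ⟨j + 1, k, ?_, rfl⟩
          have := card_step n I (i := j + 1) (by omega)
          split_ifs at this <;> omega
        · exact zero_mem _

end

/-- `M_I` is a submodule of `D_0`. -/
theorem rankOne_le (I : Finset ℕ) : rankOne n I ≤ D₀ n := by
  refine Submodule.span_le.2 ?_
  rintro _ ⟨j, _, rfl⟩
  exact Submodule.mem_span_singleton.2 ⟨_, g_mul_e j _⟩

/-- `M_I` has `Δ`-support `I`. -/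
theorem hasDeltaSupport_rankOne (I : Finset ℕ) (hI : I ⊆ Finset.Icc 1 n) :
    HasDeltaSupport n (rankOne n I) I := by
  have hI' : ∀ i ∈ I, 1 ≤ i ∧ i ≤ n := fun i hi => Finset.mem_Icc.1 (hI hi)
  refine ⟨I, inferInstance, fun k => k, fun k => hI k.2, ?_, by simp⟩
  let m : I → rankOne n I := fun i => ⟨g n (i - 1) #(Finset.Icc (i : ℕ) n \ I),
    Submodule.subset_span ⟨i - 1, by have := hI' i i.2; omega, by
      have := hI' i i.2
      rw [g, show (i : ℕ) - 1 + 1 = i by omega]⟩⟩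
  let Φ : ((k : I) → deltaProj n k) →ₗ[Delta n] rankOne n I :=
    ∑ k : I, (LinearMap.toSpanSingleton (Delta n) (rankOne n I) (m k)) ∘ₗ
      (deltaProj n k).subtype ∘ₗ LinearMap.proj k
  have hΦ : ∀ x, (Φ x : AuslanderAlg n) =
      ∑ k : I, ((x k : Delta n) : AuslanderAlg n) * g n (k - 1) #(Finset.Icc (k : ℕ) n \ I) := by
    intro x
    simp only [Φ, LinearMap.sum_apply, LinearMap.comp_apply, LinearMap.toSpanSingleton_apply,
      AddSubmonoidClass.coe_finsetSum]
    rfl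
  refine ⟨(LinearEquiv.ofBijective Φ ⟨?_, ?_⟩).symm⟩
  · rw [injective_iff_map_eq_zero]
    intro x hx
    choose c hc using fun k : I => exists_coeff (hI' k k.2).1 (x k)
    let f : (Σ k : I, Fin k) → Tri n := fun q =>
      ⟨(q.1 - 1 - q.2, #(Finset.Icc (q.1 : ℕ) n \ I) + q.2), by
        obtain ⟨⟨i, hi⟩, d⟩ := q
        obtain ⟨d, hd⟩ := d
        simp only at hd ⊢
        have h1 := hI' i hi
        have h2 := card_step n I h1.2
        rw [if_pos hi] at h2
        have h3 : #(Finset.Icc (i + 1) n \ I) ≤ n + 1 - (i + 1) := by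
          rw [← Nat.card_Icc]; exact Finset.card_le_card Finset.sdiff_subset
        omega⟩
    have hf : Function.Injective f := by
      rintro ⟨⟨i, hi⟩, d, hd⟩ ⟨⟨i', hi'⟩, d', hd'⟩ h
      simp only [f, Subtype.mk.injEq, Prod.mk.injEq] at h hd hd'
      have h1 : i = i' := by
        rcases lt_trichotomy i i' with h' | h' | h'
        · have := card_mono (n := n) I hi h' (hI' i' hi').2; omega
        · exact h'
        · have := card_mono (n := n) I hi' h' (hI' i hi).2; omega
      subst h1
      have h2 : d = d' := by omega
      subst h2
      rfl
    have hz : ∑ q : (Σ k : I, Fin k), c q.1 q.2 • g n (f q).1.1 (f q).1.2 = 0 := by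
      rw [Fintype.sum_sigma]
      have h0 := hΦ x
      rw [hx] at h0
      refine Eq.trans (Finset.sum_congr rfl fun k _ => ?_) h0.symm
      rw [← hc k, Finset.sum_mul]
      refine Finset.sum_congr rfl fun d _ => ?_
      rw [smul_mul_assoc, aPath_mul_g _ d.2]
    have hc0 := Fintype.linearIndependent_iff.1 ((linearIndependent_g n).comp f hf)
      (fun q => c q.1 q.2) hz
    funext k
    apply Subtype.ext
    apply Subtype.ext
    rw [← hc k]
    exact Finset.sum_eq_zero fun d _ => by
      have h0 : c k d = 0 := hc0 ⟨k, d⟩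
      rw [h0, zero_smul]
  · rintro ⟨y, hy⟩
    suffices h : ∃ x, (Φ x : AuslanderAlg n) = y from
      h.imp fun x hx => Subtype.ext hx
    have hy' := rankOne_le_span I hy
    clear hy
    induction hy' using Submodule.span_induction with
    | zero => exact ⟨0, by simp⟩
    | add u v _ _ hu hv =>
      obtain ⟨u', rfl⟩ := hu
      obtain ⟨v', rfl⟩ := hv
      exact ⟨u' + v', by simp⟩
    | smul r u _ hu =>
      obtain ⟨u', rfl⟩ := hu
      refine ⟨fun k => algebraMap ℂ (Delta n) r • u' k, ?_⟩
      rw [hΦ, hΦ, Finset.smul_sum]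
      refine Finset.sum_congr rfl fun k _ => ?_
      rw [Algebra.smul_def, ← mul_assoc]
      rfl
    | mem u hu =>
      obtain ⟨j, k, hk, rfl⟩ := hu
      by_cases hjk : j + k < n
      · obtain ⟨i, hi, hji, hin, heq⟩ := exists_index I hjk hk
        refine ⟨Pi.single ⟨i, hi⟩ ⟨aPath n i (i - 1 - j), aPath_mem _ _⟩, ?_⟩
        rw [hΦ, Finset.sum_eq_single ⟨i, hi⟩, Pi.single_eq_same,
          aPath_mul_g _ (by omega)]
        · congr 1
          · omega
          · change #(Finset.Icc i n \ I) + (i - 1 - j) = k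
            omega
        · intro k' _ hk'
          rw [Pi.single_eq_of_ne hk']
          simp
        · simp
      · exact ⟨0, by rw [g_eq_zero (by omega)]; simp⟩

end AuslanderAlg

/-! The elements `g n j k` with j + k < n form a basis of D_0, and M_I is spanned by those with k ≥
`gap n I j`. A path of arrows a from v down to 0 acts injectively on e_v D_0, so a homomorphism M_I
→ M_J is determined by the image of the generator at the vertex 0. Comparing this image with the
images of the other generators shows that Hom(M_I, M_J) is spanned by the right multiplications by
t^m, t^(m+1), …, where m is the maximum over j ≤ n of `gap n J j` - `gap n I j`. Exactly |I| - m of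
these matter (`rank_hom`).

The difference of gaps at j is |(I \ J) ∩ [j+1, n]| - |(J \ I) ∩ [j+1, n]|. If J' < I \ J < J'',
then as j decreases from n it falls by |J''|, climbs by |I \ J|, and falls by |J'|. Since |I| ≥ |J|,
its maximum is |I \ J| - |J''| and its minimum is -|J''|. Both Hom dimensions follow
(`rank_hom_of_isSeparation`).

For Ext, M_I has a projective resolution of length one: generators x_j of ⨁ D e_j, and between
neighbours the single relation b x_r = x_{r+1} if r + 1 ∈ I, or a x_{r+1} = x_r if not. Its
exactness rests on `IsRankOneFamily.injective`. Applying Hom(-, M_J) and counting the dimensions of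
the spaces e_v M_J gives dim Hom - dim Ext¹ = |I ∩ J| for all I, J ⊆ [n] (`sum_relVertex`,
`rank_ext`), so the Ext dimensions follow from the Hom dimensions. -/

namespace AuslanderAlg

/-! ### Coordinates on D_0 and the gap function -/

section Coordinates

variable {n : ℕ}

noncomputable instance : Fintype (Tri n) :=
  Fintype.ofInjective (fun p : Tri n => ((⟨p.1.1, by have := p.2; omega⟩,
    ⟨p.1.2, by have := p.2; omega⟩) : Fin n × Fin n)) fun p q h => by
      simp only [Prod.mk.injEq, Fin.mk.injEq] at h
      exact Subtype.ext (Prod.ext h.1 h.2)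

/-- The coordinates of an element of `D_0` in the basis `b_j ⋯ b_1 t^k`. -/
noncomputable def coord (n : ℕ) : AuslanderAlg n →ₗ[ℂ] (Tri n → ℂ) :=
  (LinearMap.applyₗ fun p : Tri n => if p.1 = (0, 0) then (1 : ℂ) else 0) ∘ₗ (act n).toLinearMap

theorem coord_g (j k : ℕ) (q : Tri n) :
    coord n (g n j k) q = if q.1 = (j, k) then 1 else 0 :=
  act_g n j k q

/-- The least exponent `k` such that `b_j ⋯ b_1 t^k` belongs to `M_I`. -/
def gap (n : ℕ) (I : Finset ℕ) (j : ℕ) : ℕ := #(Finset.Icc (j + 1) n \ I)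

theorem gap_succ (I : Finset ℕ) {j : ℕ} (hj : j < n) :
    gap n I j = (if j + 1 ∈ I then 0 else 1) + gap n I (j + 1) :=
  card_step n I hj

theorem gap_add_card (I : Finset ℕ) {j : ℕ} (hj : j ≤ n) :
    gap n I j + #(Finset.Icc (j + 1) n ∩ I) = n - j := by
  rw [gap, Finset.card_sdiff_add_card_inter, Nat.card_Icc]; omega

theorem gap_le (I : Finset ℕ) {j : ℕ} (hj : j ≤ n) : gap n I j + j ≤ n := by
  have := gap_add_card I hj
  omega

theorem gap_self (I : Finset ℕ) : gap n I n = 0 := by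
  simp [gap]

/-- The gap drops by at most one per vertex. This keeps the exponent in `aPath_smul_gen` from being
truncated. -/
theorem gap_zero_le (I : Finset ℕ) {j : ℕ} (hj : j ≤ n) : gap n I 0 ≤ gap n I j + j := by
  induction j with
  | zero => rfl
  | succ j ih =>
    have h1 := ih (by omega)
    have h2 := gap_succ (n := n) I (j := j) (by omega)
    split_ifs at h2 <;> omega

/-- The loop at j acts on e_j D_0 as right multiplication by t. No bound on j is needed, because
both sides vanish from j = n - 1 on. -/
theorem loop_mul_g (j k : ℕ) : a n (j + 1) * (b n (j + 1) * g n j k) = g n j (k + 1) := by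
  rw [b_mul_g, if_pos rfl, a_mul_g, if_pos ⟨rfl, by omega⟩, Nat.add_sub_cancel]

theorem g_mem_rankOne (I : Finset ℕ) {j k : ℕ} (h : gap n I j ≤ k) : g n j k ∈ rankOne n I := by
  by_cases hj : j < n
  · induction k, h using Nat.le_induction with
    | base => exact Submodule.subset_span ⟨j, hj, rfl⟩
    | succ k _ ih =>
      rw [← loop_mul_g, ← mul_assoc]
      exact Submodule.smul_mem _ (a n (j + 1) * b n (j + 1)) ih
  · rw [g_eq_zero (by omega)]
    exact zero_mem _

theorem sum_coord {I : Finset ℕ} {x : AuslanderAlg n} (hx : x ∈ rankOne n I) :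
    ∑ p : Tri n, coord n x p • g n p.1.1 p.1.2 = x := by
  have hx' := rankOne_le_span I hx
  clear hx
  induction hx' using Submodule.span_induction with
  | zero => simp
  | add u v _ _ hu hv =>
    simp only [map_add, Pi.add_apply, add_smul, Finset.sum_add_distrib, hu, hv]
  | smul r u _ hu =>
    simp only [map_smul, Pi.smul_apply, smul_assoc, ← Finset.smul_sum, hu]
  | mem u hu =>
    obtain ⟨j, k, -, rfl⟩ := hu
    by_cases hjk : j + k < n
    · rw [Finset.sum_eq_single ⟨(j, k), hjk⟩]
      · simp [coord_g]
      · intro p _ hp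
        rw [coord_g, if_neg fun h => hp (Subtype.ext h), zero_smul]
      · simp
    · rw [g_eq_zero (by omega)]; simp

theorem coord_eq_zero {I : Finset ℕ} {x : AuslanderAlg n} (hx : x ∈ rankOne n I) {p : Tri n}
    (hp : p.1.2 < gap n I p.1.1) : coord n x p = 0 := by
  have hx' := rankOne_le_span I hx
  clear hx
  induction hx' using Submodule.span_induction with
  | zero => simp
  | add u v _ _ hu hv => simp [hu, hv]
  | smul r u _ hu => simp [hu]
  | mem u hu =>
    obtain ⟨j, k, hk, rfl⟩ := hu
    rw [coord_g, if_neg]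
    intro h
    simp only [h] at hp
    exact absurd hk (not_le.2 hp)

theorem coord_mul {I : Finset ℕ} (w : AuslanderAlg n) {x : AuslanderAlg n}
    (hx : x ∈ rankOne n I) (q : Tri n) :
    coord n (w * x) q = ∑ p : Tri n, coord n x p * coord n (w * g n p.1.1 p.1.2) q := by
  conv_lhs => rw [← sum_coord hx]
  simp only [Finset.mul_sum, mul_smul_comm, map_sum, map_smul, Finset.sum_apply, Pi.smul_apply,
    smul_eq_mul]

theorem eq_zero_of_coord {I : Finset ℕ} {x : AuslanderAlg n} (hx : x ∈ rankOne n I)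
    (h : ∀ p, coord n x p = 0) : x = 0 := by
  rw [← sum_coord hx]; simp [h]

theorem coord_eq_zero_of_e_mul {I : Finset ℕ} {x : AuslanderAlg n} (hx : x ∈ rankOne n I) {v : ℕ}
    (he : e n v * x = x) {p : Tri n} (hp : p.1.1 ≠ v) : coord n x p = 0 := by
  rw [← he, coord_mul _ hx]
  refine Finset.sum_eq_zero fun q _ => ?_
  rw [e_mul_g]
  split_ifs with h
  · rw [coord_g, if_neg, mul_zero]
    rintro h'
    apply hp
    rw [h, h']
  · simp

/-- As a loop at the vertex 0, t kills the other vertices from the left. The case r = 0 is separate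
because t^0 is 1 here and not e_0. -/
theorem t_pow_mul_g (r j k : ℕ) : t n ^ r * g n j k = if j = 0 ∨ r = 0 then g n j (k + r) else 0 := by
  induction r with
  | zero => simp
  | succ r ih =>
    rw [pow_succ', mul_assoc, ih]
    by_cases hj : j = 0
    · subst hj
      simp only [true_or, if_true]
      rw [t, mul_assoc, loop_mul_g, add_assoc]
    · simp only [hj, false_or, Nat.add_eq_zero_iff, one_ne_zero, and_false, if_false]
      split_ifs
      · rw [t, mul_assoc, b_mul_g, if_neg (by omega), mul_zero]
      · simp

theorem aPath_mul_e (i d : ℕ) : (aPath n i d : AuslanderAlg n) * e n (i - 1) = aPath n i d := by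
  induction d with
  | zero => simp [aPath, eΔ, e_mul]
  | succ d ih => simp only [aPath, MulMemClass.coe_mul, mul_assoc, ih]

theorem aPath_mul_g' (v j k : ℕ) :
    (aPath n (v + 1) v : AuslanderAlg n) * g n j k = if j = v then g n 0 (k + v) else 0 := by
  split_ifs with h
  · subst h
    simpa using aPath_mul_g (n := n) (i := j + 1) (d := j) k (by omega)
  · rw [← aPath_mul_e, mul_assoc, e_mul_g, if_neg (by simp; omega), mul_zero]

/-- Moving an element of `e_v D_0` to the vertex `0` shifts its coordinates. -/
theorem coord_aPath_mul {I : Finset ℕ} {x : AuslanderAlg n} (hx : x ∈ rankOne n I) (v k : ℕ)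
    (h : 0 + k < n) :
    coord n ((aPath n (v + 1) v : AuslanderAlg n) * x) ⟨(0, k), h⟩ =
      if h : v ≤ k then coord n x ⟨(v, k - v), by simp only; omega⟩ else 0 := by
  rw [coord_mul _ hx]
  simp only [aPath_mul_g']
  split_ifs with hv
  · rw [Finset.sum_eq_single ⟨(v, k - v), by simp only; omega⟩]
    · simp only [if_true, coord_g]
      rw [if_pos (by simp; omega), mul_one]
    · rintro ⟨⟨j, l⟩, hq⟩ _ hne
      simp only [ne_eq, Subtype.mk.injEq, Prod.mk.injEq] at hne
      split_ifs with hj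
      · change j = v at hj
        rw [coord_g, if_neg (by simp; omega), mul_zero]
      · simp
    · simp
  · refine Finset.sum_eq_zero fun q _ => ?_
    split_ifs with hj
    · rw [coord_g, if_neg (by simp; omega), mul_zero]
    · simp

theorem coord_t_pow_mul {I : Finset ℕ} {x : AuslanderAlg n} (hx : x ∈ rankOne n I) (r k : ℕ)
    (h : 0 + (k + r) < n) :
    coord n (t n ^ r * x) ⟨(0, k + r), h⟩ = coord n x ⟨(0, k), by simp only; omega⟩ := by
  rw [coord_mul _ hx]
  simp only [t_pow_mul_g]
  rw [Finset.sum_eq_single ⟨(0, k), by simp only; omega⟩]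
  · simp [coord_g]
  · rintro ⟨⟨j, l⟩, hq⟩ _ hne
    simp only [ne_eq, Subtype.mk.injEq, Prod.mk.injEq] at hne
    split_ifs with hj
    · rw [coord_g, if_neg (by simp; omega), mul_zero]
    · simp
  · simp

end Coordinates

/-! ### Homomorphisms between rank one modules -/

section Hom

variable {n : ℕ}

/-- The generator of `M_I` at the vertex `j`. -/
noncomputable def gen (n : ℕ) (I : Finset ℕ) (j : ℕ) : rankOne n I :=
  ⟨g n j (gap n I j), g_mem_rankOne I le_rfl⟩

theorem span_gen (I : Finset ℕ) :
    Submodule.span (AuslanderAlg n) (Set.range fun j : Fin n => gen n I j) = ⊤ := by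
  apply Submodule.map_injective_of_injective (rankOne n I).injective_subtype
  rw [Submodule.map_span, Submodule.map_top, Submodule.range_subtype]
  change _ = Submodule.span _ _
  congr 1
  ext x
  constructor
  · rintro ⟨_, ⟨j, rfl⟩, rfl⟩
    exact ⟨j, j.2, rfl⟩
  · rintro ⟨j, hj, rfl⟩
    exact ⟨_, ⟨⟨j, hj⟩, rfl⟩, rfl⟩

theorem e_smul_gen (I : Finset ℕ) (j : ℕ) : e n j • gen n I j = gen n I j :=
  Subtype.ext <| by
    change e n j * g n j _ = _
    rw [e_mul_g, if_pos rfl]; rfl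

/-- Each arrow a raises the exponent of t by one, so both sides are `g n 0 (gap n I j + j)`. This is
the only link between generators that the computation of Hom needs. -/
theorem aPath_smul_gen (I : Finset ℕ) {j : ℕ} (hj : j ≤ n) :
    (aPath n (j + 1) j : AuslanderAlg n) • gen n I j =
      t n ^ (gap n I j + j - gap n I 0) • gen n I 0 :=
  Subtype.ext <| by
    change (aPath n (j + 1) j : AuslanderAlg n) * g n j _ = t n ^ _ * g n 0 _
    have := gap_zero_le I hj
    rw [aPath_mul_g', if_pos rfl, t_pow_mul_g, if_pos (Or.inl rfl)]
    congr 1; omega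

variable {I J : Finset ℕ}

theorem hom_aPath (f : rankOne n I →ₗ[AuslanderAlg n] rankOne n J) {j : ℕ} (hj : j ≤ n) :
    (aPath n (j + 1) j : AuslanderAlg n) * (f (gen n I j) : AuslanderAlg n) =
      t n ^ (gap n I j + j - gap n I 0) * (f (gen n I 0) : AuslanderAlg n) := by
  have := congrArg f (aPath_smul_gen I hj)
  rw [map_smul, map_smul] at this
  exact congrArg Subtype.val this

theorem e_mul_hom_gen (f : rankOne n I →ₗ[AuslanderAlg n] rankOne n J) (j : ℕ) :
    e n j * (f (gen n I j) : AuslanderAlg n) = f (gen n I j) := by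
  have := congrArg f (e_smul_gen I j)
  rw [map_smul] at this
  exact congrArg Subtype.val this

/-- A homomorphism `M_I → M_J` is determined by its value at the generator at the vertex `0`. -/
theorem hom_eq_zero {f : rankOne n I →ₗ[AuslanderAlg n] rankOne n J}
    (h : f (gen n I 0) = 0) : f = 0 := by
  apply LinearMap.ext_on (span_gen I)
  rintro _ ⟨j, rfl⟩
  apply Subtype.ext
  apply eq_zero_of_coord (f (gen n I j)).2
  rintro ⟨⟨v, k⟩, hvk⟩
  by_cases hv : v = j
  · subst hv
    have h1 := hom_aPath f j.2.le
    rw [h] at h1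
    have hvk' : (j : ℕ) + k < n := hvk
    -- The coordinate (j, k) survives the descent to the vertex 0 as the coordinate (0, k + j), and
    -- there the image is a multiple of the image of `gen n I 0`.
    have h2 := coord_aPath_mul (f (gen n I j)).2 j (k + j) (by omega)
    rw [h1, dif_pos (by omega)] at h2
    simp only [Nat.add_sub_cancel] at h2
    rw [← h2]; simp
  · exact coord_eq_zero_of_e_mul (f (gen n I j)).2 (e_mul_hom_gen f j) hv

/-- Multiplication by a power of `t`, as a homomorphism `M_I → M_J`. -/
noncomputable def mulPow (m : ℕ) (h : ∀ j ≤ n, gap n J j ≤ gap n I j + m) :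
    rankOne n I →ₗ[AuslanderAlg n] rankOne n J :=
  (LinearMap.toSpanSingleton (AuslanderAlg n) (AuslanderAlg n) (t n ^ m)).restrict <| by
    change rankOne n I ≤ (rankOne n J).comap _
    refine Submodule.span_le.2 ?_
    rintro _ ⟨j, hj, rfl⟩
    change bPath n j * t n ^ gap n I j * t n ^ m ∈ rankOne n J
    rw [mul_assoc, ← pow_add]
    exact g_mem_rankOne J (h j hj.le)

/-- Evaluation of homomorphisms at the generator at the vertex `0`. -/
noncomputable def evalGen (n : ℕ) (I J : Finset ℕ) :
    (rankOneMod n I ⟶ rankOneMod n J) →ₗ[ℂ] AuslanderAlg n where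
  toFun f := (f.hom (gen n I 0) : rankOne n J)
  map_add' _ _ := rfl
  map_smul' r f := by
    rw [RingHom.id_apply, Algebra.smul_def]; rfl

theorem evalGen_injective : Function.Injective (evalGen n I J) := by
  rw [injective_iff_map_eq_zero]
  intro f hf
  exact ModuleCat.hom_ext (hom_eq_zero (Subtype.ext hf))

/-- The bound `h` lets every power of t from m on map M_I into M_J. Equality at v excludes smaller
exponents. -/
theorem range_evalGen {m v : ℕ} (h : ∀ j ≤ n, gap n J j ≤ gap n I j + m) (hv : v ≤ n)
    (hm : gap n J v = gap n I v + m) :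
    LinearMap.range (evalGen n I J) = Submodule.span ℂ
      (Set.range fun i : Fin (n - gap n I 0 - m) => g n 0 (gap n I 0 + m + i)) := by
  apply le_antisymm
  · rintro _ ⟨f, rfl⟩
    have hy := (f.hom (gen n I 0)).2
    have hz := (f.hom (gen n I v)).2
    change (f.hom (gen n I 0) : rankOne n J).1 ∈ _
    rw [← sum_coord hy]
    refine Submodule.sum_mem _ fun p _ => ?_
    obtain ⟨⟨j, k⟩, hp⟩ := p
    have hp' : j + k < n := hp
    by_cases hj : j = 0
    swap
    · rw [coord_eq_zero_of_e_mul hy (e_mul_hom_gen f.hom 0) hj, zero_smul]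
      exact zero_mem _
    subst hj
    by_cases hk : gap n I 0 + m ≤ k
    · refine Submodule.smul_mem _ _ (Submodule.subset_span ⟨⟨k - gap n I 0 - m, by omega⟩, ?_⟩)
      simp only
      congr 1; omega
    have hle := gap_le J hv
    have hle' := gap_zero_le I hv
    -- The coefficient at (0, k) is carried to the vertex v, where it becomes the coordinate of the
    -- image of `gen n I v` with exponent k + `gap n I v` - `gap n I 0`. For k < `gap n I 0` + m
    -- this lies below `gap n J v`, or is negative, so the coefficient is zero.
    rw [← coord_t_pow_mul hy (gap n I v + v - gap n I 0) k (by omega), ← hom_aPath f.hom hv,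
      coord_aPath_mul hz]
    split_ifs with hvk
    · rw [coord_eq_zero hz, zero_smul]
      · exact zero_mem _
      · simp only; omega
    · rw [zero_smul]
      exact zero_mem _
  · rw [Submodule.span_le]
    rintro _ ⟨i, rfl⟩
    refine ⟨ModuleCat.ofHom (mulPow (m + i) fun j hj => (h j hj).trans (by omega)), ?_⟩
    change g n 0 (gap n I 0) * t n ^ (m + (i : ℕ)) = _
    rw [g, mul_assoc, ← pow_add, ← add_assoc]; rfl

/-- The exponents of t that occur run from `gap n I 0 + m` to n - 1, and n - `gap n I 0` = |I|
because I ⊆ [n]. -/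
theorem rank_hom (hI : I ⊆ Finset.Icc 1 n) {m v : ℕ} (h : ∀ j ≤ n, gap n J j ≤ gap n I j + m)
    (hv : v ≤ n) (hm : gap n J v = gap n I v + m) :
    Module.rank ℂ (rankOneMod n I ⟶ rankOneMod n J) = ((#I - m : ℕ) : Cardinal) := by
  have hli : LinearIndependent ℂ
      (fun i : Fin (n - gap n I 0 - m) => g n 0 (gap n I 0 + m + i)) :=
    (linearIndependent_g n).comp
      (fun i : Fin (n - gap n I 0 - m) => (⟨(0, gap n I 0 + m + i), by simp only; omega⟩ : Tri n))
      fun i j hij => by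
        simp only [Subtype.mk.injEq, Prod.mk.injEq] at hij
        exact Fin.ext (by omega)
  have hc := gap_add_card (n := n) I (Nat.zero_le n)
  rw [zero_add, Finset.inter_eq_right.2 hI] at hc
  rw [(LinearEquiv.ofInjective _ evalGen_injective).rank_eq, range_evalGen h hv hm,
    rank_eq_card_basis (Module.Basis.span hli), Fintype.card_fin]
  congr 1; omega

end Hom

end AuslanderAlg

/-! ### Dimension shifting for Ext¹ -/

open CategoryTheory Abelian in
/-- Dimension shifting along a short exact sequence with projective middle term. -/
theorem rank_ext_one_add_rank_hom {k : Type} [Field k] {C : Type*} [Category.{0} C] [Abelian C]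
    [Linear k C] [HasExt.{0} C] {S : ShortComplex C} (hS : S.ShortExact) [Projective S.X₂] (Y : C) :
    Module.rank k (Ext S.X₃ Y 1) + Module.rank k (S.X₂ ⟶ Y) =
      Module.rank k (S.X₁ ⟶ Y) + Module.rank k (S.X₃ ⟶ Y) := by
  have := hS.epi_g
  let α : (S.X₃ ⟶ Y) →ₗ[k] (S.X₂ ⟶ Y) := Linear.leftComp k Y S.g
  let β : (S.X₂ ⟶ Y) →ₗ[k] (S.X₁ ⟶ Y) := Linear.leftComp k Y S.f
  let δ : (S.X₁ ⟶ Y) →ₗ[k] Ext S.X₃ Y 1 :=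
    (Ext.precompOfLinear hS.extClass k Y (add_zero 1)) ∘ₗ
      (Ext.linearEquiv₀ (R := k)).symm.toLinearMap
  have hδ : ∀ f, δ f = hS.extClass.comp (Ext.mk₀ f) (add_zero 1) := fun f => rfl
  have hα : Function.Injective α := fun u v h => (cancel_epi S.g).1 h
  have hδs : Function.Surjective δ := by
    intro x
    obtain ⟨y, hy⟩ := Ext.contravariant_sequence_exact₃ hS Y x (Ext.eq_zero_of_projective _)
      (add_zero 1)
    obtain ⟨f, rfl⟩ := (Ext.linearEquiv₀ (R := k)).symm.surjective y
    exact ⟨f, hy⟩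
  have hαβ : LinearMap.ker β = LinearMap.range α := by
    ext f
    constructor
    · intro hf
      have hf : S.f ≫ f = 0 := hf
      exact ⟨hS.exact.desc f hf, hS.exact.g_desc f hf⟩
    · rintro ⟨f, rfl⟩
      change S.f ≫ S.g ≫ f = 0
      rw [← Category.assoc, S.zero, Limits.zero_comp]
  have hβδ : LinearMap.ker δ = LinearMap.range β := by
    ext f
    constructor
    · intro hf
      have hf : hS.extClass.comp (Ext.mk₀ f) (add_zero 1) = 0 := hf
      obtain ⟨y, hy⟩ := Ext.contravariant_sequence_exact₁ hS Y _ (add_zero 1) hf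
      obtain ⟨h, rfl⟩ := (Ext.linearEquiv₀ (R := k)).symm.surjective y
      refine ⟨h, (Ext.linearEquiv₀ (R := k)).symm.injective ?_⟩
      rw [Ext.linearEquiv₀_symm_apply, Ext.mk₀_comp_mk₀] at hy
      exact hy
    · rintro ⟨f, rfl⟩
      change hS.extClass.comp (Ext.mk₀ (S.f ≫ f)) (add_zero 1) = 0
      rw [← Ext.mk₀_comp_mk₀, ← Ext.comp_assoc _ _ _ (add_zero 1) (add_zero 0) (by omega),
        hS.extClass_comp, Ext.zero_comp]
  -- Rank-nullity along the exact sequence 0 → Hom(X₃, Y) → Hom(X₂, Y) → Hom(X₁, Y) → Ext¹(X₃, Y) →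
  -- 0. The additive form needs no finiteness.
  have h1 := LinearMap.rank_range_add_rank_ker δ
  have h2 := LinearMap.rank_range_add_rank_ker β
  rw [LinearMap.range_eq_top.2 hδs, rank_top, hβδ] at h1
  rw [hαβ, (LinearEquiv.ofInjective α hα).symm.rank_eq] at h2
  rw [← h1, ← h2, add_assoc]

namespace AuslanderAlg

/-! ### Modules presented by the generators and relations of M_I -/

section Presentation

variable {n : ℕ}

theorem stable_of_generators {Q : Type*} [AddCommGroup Q] [Module ℂ Q] [Module (AuslanderAlg n) Q]
    [IsScalarTower ℂ (AuslanderAlg n) Q] (W : Submodule ℂ Q)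
    (he : ∀ i, ∀ w ∈ W, e n i • w ∈ W) (ha : ∀ i, ∀ w ∈ W, a n i • w ∈ W)
    (hb : ∀ i, ∀ w ∈ W, b n i • w ∈ W) (x : AuslanderAlg n) : ∀ w ∈ W, x • w ∈ W := by
  have hx : x ∈ Algebra.adjoin ℂ (Set.range (e n) ∪ Set.range (a n) ∪ Set.range (b n)) :=
    adjoin_eq_top (n := n) ▸ Algebra.mem_top
  induction hx using Algebra.adjoin_induction with
  | mem s hs => rcases hs with (⟨i, rfl⟩ | ⟨i, rfl⟩) | ⟨i, rfl⟩; exacts [he i, ha i, hb i]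
  | algebraMap r => intro w hw; rw [algebraMap_smul]; exact W.smul_mem r hw
  | add x y _ _ hx hy => intro w hw; rw [add_smul]; exact W.add_mem (hx w hw) (hy w hw)
  | mul x y _ _ hx hy => intro w hw; rw [mul_smul]; exact hx _ (hy w hw)

/-- The loop `a_{v+1} b_{v+1}` at the vertex `v`. -/
noncomputable def loop (n v : ℕ) : AuslanderAlg n := a n (v + 1) * b n (v + 1)

/-- The loops at the various vertices are the components of one central element of D. This lemma and
the next two say that b, a and e commute past it. -/
theorem semiconj_b (v : ℕ) : SemiconjBy (b n (v + 1)) (loop n v) (loop n (v + 1)) := by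
  rw [SemiconjBy, loop, loop, comm, mul_assoc]

theorem semiconj_a (v : ℕ) : SemiconjBy (a n (v + 1)) (loop n (v + 1)) (loop n v) := by
  rw [SemiconjBy, loop, loop, comm, mul_assoc]

theorem semiconj_e (v : ℕ) : SemiconjBy (e n v) (loop n v) (loop n v) := by
  rw [SemiconjBy, loop, mul_assoc, ← b_mul_e (v + 1), ← e_mul_a (v + 1)]
  simp only [Nat.add_sub_cancel, ← mul_assoc, e_mul, if_true]
  simp only [mul_assoc, e_mul, if_true]

variable {Q : Type*} [AddCommGroup Q] [Module (AuslanderAlg n) Q]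

/-- A family of elements satisfying the relations between the generators of `M_I`. -/
structure IsRankOneFamily (I : Finset ℕ) (x : ℕ → Q) : Prop where
  -- The fictitious vertex v = n is included: e_n = 0 forces x n = 0, so the relation at n - 1 says
  -- that x (n - 1) = 0 when n ∉ I and is empty otherwise.
  e_smul : ∀ v ≤ n, e n v • x v = x v
  b_smul : ∀ v < n, v + 1 ∈ I → b n (v + 1) • x v = x (v + 1)
  a_smul : ∀ v < n, v + 1 ∉ I → a n (v + 1) • x (v + 1) = x v

namespace IsRankOneFamily

variable {I : Finset ℕ} {x : ℕ → Q}

theorem e_smul_loop (h : IsRankOneFamily (n := n) I x) (w : ℕ) {v : ℕ} (hv : v ≤ n) (m : ℕ) :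
    e n w • loop n v ^ m • x v = if w = v then loop n v ^ m • x v else 0 := by
  have h1 : e n v • loop n v ^ m • x v = loop n v ^ m • x v := by
    rw [← mul_smul, ((semiconj_e v).pow_right m).eq, mul_smul, h.e_smul v hv]
  rw [← h1, ← mul_smul, e_mul]
  split_ifs with hw
  · rw [hw]
  · rw [zero_smul]

/-- If v + 1 ∉ I, then x v = a x (v + 1), and b a is the loop at v + 1. This accounts for the extra
exponent. -/
theorem b_smul_loop (h : IsRankOneFamily (n := n) I x) {v : ℕ} (hv : v < n) (m : ℕ) :
    b n (v + 1) • loop n v ^ m • x v =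
      loop n (v + 1) ^ (m + if v + 1 ∈ I then 0 else 1) • x (v + 1) := by
  rw [← mul_smul, ((semiconj_b v).pow_right m).eq, mul_smul]
  split_ifs with hI
  · rw [h.b_smul v hv hI, add_zero]
  · rw [← h.a_smul v hv hI, ← mul_smul (b n _), ← comm, ← mul_smul, pow_succ]
    rfl

theorem a_smul_loop (h : IsRankOneFamily (n := n) I x) {v : ℕ} (hv : v < n) (m : ℕ) :
    a n (v + 1) • loop n (v + 1) ^ m • x (v + 1) =
      loop n v ^ (m + if v + 1 ∈ I then 1 else 0) • x v := by
  rw [← mul_smul, ((semiconj_a v).pow_right m).eq, mul_smul]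
  split_ifs with hI
  · rw [← h.b_smul v hv hI, ← mul_smul (a n _), ← mul_smul, pow_succ]
    rfl
  · rw [h.a_smul v hv hI, add_zero]

/-- The vanishing of x n propagates down along the arrows a. The bound is the one beyond which `g n
v (gap n I v + m)` vanishes. -/
theorem loop_smul_eq_zero (h : IsRankOneFamily (n := n) I x) {v : ℕ} (hv : v ≤ n) {m : ℕ}
    (hm : n ≤ v + gap n I v + m) : loop n v ^ m • x v = 0 := by
  induction hv using Nat.decreasingInduction generalizing m with
  | self => rw [← h.e_smul n le_rfl, e_out le_rfl, zero_smul, smul_zero]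
  | of_succ v hv ih =>
    have h1 := gap_succ (n := n) I hv
    have h2 := gap_le (n := n) I (j := v + 1) hv
    by_cases hI : v + 1 ∈ I
    · rw [if_pos hI] at h1
      obtain ⟨m, rfl⟩ : ∃ m', m = m' + 1 := ⟨m - 1, by omega⟩
      have h3 := h.a_smul_loop hv m
      rw [if_pos hI] at h3
      rw [← h3, ih (by omega), smul_zero]
    · rw [if_neg hI] at h1
      have h3 := h.a_smul_loop hv m
      rw [if_neg hI, add_zero] at h3
      rw [← h3, ih (by omega), smul_zero]

variable [Module ℂ Q] [IsScalarTower ℂ (AuslanderAlg n) Q]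

/-- The multiples of the generators by powers of loops are permuted or killed by the generators of
D, so their span is a D-submodule. Shifting the exponent by the gap indexes the nonzero ones by the
basis of M_I. -/
theorem span_loop (h : IsRankOneFamily (n := n) I x)
    (hx : Submodule.span (AuslanderAlg n) (Set.range fun v : Fin n => x v) = ⊤) :
    Submodule.span ℂ (Set.range fun p : {p : Tri n // gap n I p.1.1 ≤ p.1.2} =>
      loop n p.1.1.1 ^ (p.1.1.2 - gap n I p.1.1.1) • x p.1.1.1) = ⊤ := by
  set W := Submodule.span ℂ (Set.range fun p : {p : Tri n // gap n I p.1.1 ≤ p.1.2} =>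
      loop n p.1.1.1 ^ (p.1.1.2 - gap n I p.1.1.1) • x p.1.1.1)
  have hu : ∀ v ≤ n, ∀ m, loop n v ^ m • x v ∈ W := by
    intro v hv m
    by_cases hm : n ≤ v + gap n I v + m
    · rw [h.loop_smul_eq_zero hv hm]
      exact zero_mem _
    · refine Submodule.subset_span ⟨⟨⟨(v, gap n I v + m), by simp only; omega⟩, by simp⟩, ?_⟩
      simp
  have stable : ∀ y : AuslanderAlg n, (∀ v < n, ∀ m, y • loop n v ^ m • x v ∈ W) →
      ∀ w ∈ W, y • w ∈ W := by
    intro y hy w hw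
    induction hw using Submodule.span_induction with
    | zero => simp
    | add u v _ _ hu hv => rw [smul_add]; exact add_mem hu hv
    | smul r u _ hu =>
      rw [← algebraMap_smul (AuslanderAlg n) r u, ← mul_smul, ← Algebra.commutes, mul_smul,
        algebraMap_smul]
      exact Submodule.smul_mem _ r hu
    | mem u hu =>
      obtain ⟨⟨⟨⟨v, k⟩, hp⟩, hk⟩, rfl⟩ := hu
      exact hy v (by simp only at hp; omega) _
  have hD : ∀ y : AuslanderAlg n, ∀ w ∈ W, y • w ∈ W := by
    apply stable_of_generators
    · refine fun i => stable _ fun v hv m => ?_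
      rw [h.e_smul_loop i hv.le]
      split_ifs
      · exact hu v hv.le m
      · exact zero_mem _
    · refine fun i => stable _ fun v hv m => ?_
      by_cases hi : i = v ∧ 1 ≤ i
      · obtain ⟨rfl, hi⟩ := hi
        obtain ⟨i, rfl⟩ := Nat.exists_eq_add_of_le' hi
        rw [h.a_smul_loop (by omega)]
        exact hu _ (by omega) _
      · rw [← a_mul_e, mul_smul, h.e_smul_loop i hv.le]
        split_ifs with hiv
        · rw [a_out (by omega), zero_smul]; exact zero_mem _
        · rw [smul_zero]; exact zero_mem _
    · refine fun i => stable _ fun v hv m => ?_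
      by_cases hi : i = v + 1
      · rw [hi, h.b_smul_loop hv]
        exact hu _ (by omega) _
      · rw [← b_mul_e, mul_smul, h.e_smul_loop _ hv.le]
        split_ifs with hiv
        · rw [b_out (by omega), zero_smul]; exact zero_mem _
        · rw [smul_zero]; exact zero_mem _
  let W' : Submodule (AuslanderAlg n) Q :=
    { carrier := W
      add_mem' := fun hx hy => W.add_mem hx hy
      zero_mem' := W.zero_mem
      smul_mem' := fun y w hw => hD y w hw }
  have hW' : W' = ⊤ := by
    rw [← top_le_iff, ← hx, Submodule.span_le]
    rintro _ ⟨v, rfl⟩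
    have := hu v v.2.le 0
    rwa [pow_zero, one_smul] at this
  rw [eq_top_iff]
  intro y _
  exact (hW' ▸ Submodule.mem_top : y ∈ W')

/-- A module generated by such a family is no larger than M_I: its spanning set goes to distinct
basis vectors of D_0. This is applied to D e_j and to the cokernel of the relation map. -/
theorem injective (h : IsRankOneFamily (n := n) I x)
    (hx : Submodule.span (AuslanderAlg n) (Set.range fun v : Fin n => x v) = ⊤)
    (φ : Q →ₗ[AuslanderAlg n] AuslanderAlg n) (hφ : ∀ v < n, φ (x v) = g n v (gap n I v)) :
    Function.Injective φ := by
  have hφ' : ∀ v < n, ∀ m, φ (loop n v ^ m • x v) = g n v (gap n I v + m) := by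
    intro v hv m
    induction m with
    | zero => rw [pow_zero, one_smul, hφ v hv, add_zero]
    | succ m ih =>
      rw [pow_succ', mul_smul, map_smul, ih, loop, smul_eq_mul, mul_assoc, loop_mul_g, add_assoc]
  rw [injective_iff_map_eq_zero]
  intro y hy
  have hmem : y ∈ (⊤ : Submodule ℂ Q) := Submodule.mem_top
  rw [← h.span_loop hx, Submodule.mem_span_range_iff_exists_fun] at hmem
  obtain ⟨c, rfl⟩ := hmem
  have hli := (linearIndependent_g n).comp
    (Subtype.val : {p : Tri n // gap n I p.1.1 ≤ p.1.2} → Tri n) Subtype.val_injective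
  refine Finset.sum_eq_zero fun p _ => ?_
  rw [Fintype.linearIndependent_iff.1 hli c ?_ p, zero_smul]
  rw [map_sum] at hy
  refine Eq.trans (Finset.sum_congr rfl fun q _ => ?_) hy
  obtain ⟨⟨⟨v, k⟩, hp⟩, hk⟩ := q
  simp only at hp hk
  rw [LinearMap.map_smul_of_tower, hφ' v (by omega)]
  simp only [Function.comp_apply]
  congr 2; omega

end IsRankOneFamily

end Presentation

end AuslanderAlg

namespace AuslanderAlg

/-! ### The projectives D e_j as rank one modules -/

section Projectives

variable {n : ℕ}

/-- The indecomposable projective module `D e_j`. -/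
noncomputable def vertexProj (n j : ℕ) : Submodule (AuslanderAlg n) (AuslanderAlg n) :=
  Submodule.span (AuslanderAlg n) {e n j}

/-- The generator `e_j` of `D e_j`. -/
noncomputable def vertexGen (n j : ℕ) : vertexProj n j := ⟨e n j, Submodule.subset_span rfl⟩

theorem mul_e_of_mem {j : ℕ} {x : AuslanderAlg n} (hx : x ∈ vertexProj n j) : x * e n j = x := by
  obtain ⟨y, rfl⟩ := Submodule.mem_span_singleton.1 hx
  rw [smul_eq_mul, mul_assoc, e_mul, if_pos rfl]

theorem smul_vertexGen {j : ℕ} (x : vertexProj n j) :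
    (x : AuslanderAlg n) • vertexGen n j = x :=
  Subtype.ext (mul_e_of_mem x.2)

theorem mem_vertexProj {j : ℕ} {x : AuslanderAlg n} (hx : x * e n j = x) : x ∈ vertexProj n j :=
  Submodule.mem_span_singleton.2 ⟨x, hx⟩

instance (j : ℕ) : Module.Projective (AuslanderAlg n) (vertexProj n j) :=
  Module.Projective.of_split (vertexProj n j).subtype
    (LinearMap.toSpanSingleton (AuslanderAlg n) (vertexProj n j) (vertexGen n j))
    (LinearMap.ext smul_vertexGen)

/-- The path `b_{j+d} ⋯ b_{j+1}` from `j` to `j + d`. -/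
noncomputable def bPathFrom (n j : ℕ) : ℕ → AuslanderAlg n
  | 0 => e n j
  | d + 1 => b n (j + d + 1) * bPathFrom n j d

theorem bPathFrom_mem (j d : ℕ) : bPathFrom n j d ∈ vertexProj n j := by
  induction d with
  | zero => exact Submodule.subset_span rfl
  | succ d ih => exact Submodule.smul_mem _ (b n (j + d + 1)) ih

theorem e_mul_bPathFrom (j d : ℕ) : e n (j + d) * bPathFrom n j d = bPathFrom n j d := by
  cases d with
  | zero => simp [bPathFrom, e_mul]
  | succ d => rw [bPathFrom, ← mul_assoc, ← add_assoc, e_mul_b]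

theorem bPathFrom_mul_bPath (j d : ℕ) : bPathFrom n j d * bPath n j = bPath n (j + d) := by
  induction d with
  | zero => rw [bPathFrom, e_mul_bPath, if_pos rfl]; rfl
  | succ d ih => rw [bPathFrom, mul_assoc, ih]; rfl

theorem coe_aPath_mem_vertexProj (j d : ℕ) :
    (aPath n (j + 1) d : AuslanderAlg n) ∈ vertexProj n j :=
  mem_vertexProj (aPath_mul_e (j + 1) d)

/-- The shortest path from `j` to `v`, as an element of `D e_j`. -/
noncomputable def pathTo (n j v : ℕ) : vertexProj n j :=
  if j ≤ v then ⟨bPathFrom n j (v - j), bPathFrom_mem j _⟩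
  else ⟨aPath n (j + 1) (j - v), coe_aPath_mem_vertexProj j _⟩

theorem pathTo_self (j : ℕ) : pathTo n j j = vertexGen n j := by
  rw [pathTo, if_pos le_rfl]
  exact Subtype.ext (by simp [bPathFrom, vertexGen])

/-- Shortest paths from j are extended by b above j and by a below j. So D e_j satisfies the
relations of M_I with I = {j + 1, …, n}. -/
theorem isRankOneFamily_pathTo (j : ℕ) :
    IsRankOneFamily (n := n) (Finset.Icc (j + 1) n) (pathTo n j) where
  e_smul v hv := by
    apply Subtype.ext
    rw [pathTo]
    split_ifs with h
    · have := e_mul_bPathFrom (n := n) j (v - j)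
      rwa [Nat.add_sub_cancel' h] at this
    · refine (e_mul_aPath v (j + 1) (j - v)).trans (if_pos ?_)
      omega
  b_smul v hv hI := by
    have hj : j ≤ v := by simp at hI; omega
    rw [pathTo, pathTo, if_pos hj, if_pos (by omega)]
    apply Subtype.ext
    obtain ⟨d, rfl⟩ := Nat.exists_eq_add_of_le hj
    change b n (j + d + 1) * bPathFrom n j (j + d - j) = bPathFrom n j (j + d + 1 - j)
    rw [show j + d + 1 - j = d + 1 by omega, Nat.add_sub_cancel_left]
    rfl
  a_smul v hv hI := by
    have hj : v < j := by simp at hI; omega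
    have h1 : (pathTo n j (v + 1) : AuslanderAlg n) = aPath n (j + 1) (j - (v + 1)) := by
      -- For target j the definition takes the branch of paths b, but both branches give the trivial
      -- path there.
      by_cases hj' : j = v + 1
      · rw [← hj', pathTo_self, Nat.sub_self]
        rfl
      · rw [pathTo, if_neg (by omega)]
    apply Subtype.ext
    change a n (v + 1) * (pathTo n j (v + 1) : AuslanderAlg n) = _
    rw [h1, a_mul_aPath, if_pos (by omega), pathTo, if_neg (by omega)]
    change (aPath n (j + 1) _ : AuslanderAlg n) = aPath n (j + 1) _
    congr 2; omega

theorem gap_Icc {j v : ℕ} (hj : j ≤ n) : gap n (Finset.Icc (j + 1) n) v = j - v := by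
  have : Finset.Icc (v + 1) n \ Finset.Icc (j + 1) n = Finset.Icc (v + 1) j := by
    ext x; simp only [Finset.mem_sdiff, Finset.mem_Icc]; omega
  rw [gap, this, Nat.card_Icc]; omega

/-- Right multiplication by the path `b_j ⋯ b_1` embeds `D e_j` into `D_0`. -/
theorem mul_bPath_injective {j : ℕ} {x : AuslanderAlg n} (hx : x ∈ vertexProj n j)
    (h : x * bPath n j = 0) : x = 0 := by
  by_cases hj : j < n
  · have hspan : Submodule.span (AuslanderAlg n) (Set.range fun v : Fin n => pathTo n j v) = ⊤ := by
      rw [eq_top_iff]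
      intro y _
      rw [← smul_vertexGen y, ← pathTo_self]
      exact Submodule.smul_mem _ _ (Submodule.subset_span ⟨⟨j, hj⟩, rfl⟩)
    have hinj := (isRankOneFamily_pathTo (n := n) j).injective hspan
      ((LinearMap.toSpanSingleton (AuslanderAlg n) (AuslanderAlg n) (bPath n j)) ∘ₗ
        (vertexProj n j).subtype) (fun v hv => by
          change (pathTo n j v : AuslanderAlg n) * bPath n j = _
          rw [gap_Icc hj.le, pathTo]
          split_ifs with hjv
          · rw [bPathFrom_mul_bPath, Nat.add_sub_cancel' hjv, Nat.sub_eq_zero_of_le hjv, g,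
              pow_zero, mul_one]
          · have := aPath_mul_g (n := n) (i := j + 1) (d := j - v) 0 (by omega)
            rw [Nat.add_sub_cancel, g, pow_zero, mul_one] at this
            rw [this]
            congr 1 <;> omega)
    exact congrArg Subtype.val (@hinj ⟨x, hx⟩ 0 (by rw [map_zero]; exact h))
  -- For j ≥ n the module D e_j is zero. The case j = n occurs, since the last relation may sit at
  -- the vertex n.
  · rw [← mul_e_of_mem hx, e_out (by omega), mul_zero]

theorem mul_b_injective {j : ℕ} {x : AuslanderAlg n} (hx : x ∈ vertexProj n (j + 1))
    (h : x * b n (j + 1) = 0) : x = 0 := by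
  apply mul_bPath_injective hx
  rw [bPath, ← mul_assoc, h, zero_mul]

end Projectives

/-! ### The projective resolution of M_I -/

section Resolution

variable {n : ℕ}

/-- The projective module `⨁ D e_{f j}`. -/
abbrev ProjSum (n : ℕ) (f : Fin n → ℕ) : Type := (j : Fin n) → vertexProj n (f j)

/-- The map `⨁ D e_{f j} → M` sending the `j`-th generator to `y j`. -/
noncomputable def projLift {f : Fin n → ℕ} {M : Type} [AddCommGroup M] [Module (AuslanderAlg n) M]
    (y : Fin n → M) : ProjSum n f →ₗ[AuslanderAlg n] M :=
  ∑ j, (LinearMap.toSpanSingleton (AuslanderAlg n) M (y j)) ∘ₗ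
    (vertexProj n (f j)).subtype ∘ₗ LinearMap.proj j

theorem projLift_apply {f : Fin n → ℕ} {M : Type} [AddCommGroup M] [Module (AuslanderAlg n) M]
    (y : Fin n → M) (z : ProjSum n f) : projLift y z = ∑ j, (z j : AuslanderAlg n) • y j := by
  simp [projLift, LinearMap.sum_apply]

theorem projLift_single {f : Fin n → ℕ} {M : Type} [AddCommGroup M] [Module (AuslanderAlg n) M]
    (y : Fin n → M) (j : Fin n) :
    projLift y (Pi.single j (vertexGen n (f j)) : ProjSum n f) = e n (f j) • y j := by
  rw [projLift_apply, Finset.sum_eq_single j]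
  · rw [Pi.single_eq_same]; rfl
  · intro i _ hi
    rw [Pi.single_eq_of_ne hi]; simp
  · simp

theorem sum_smul_single {f : Fin n → ℕ} (z : ProjSum n f) :
    ∑ j, (z j : AuslanderAlg n) • (Pi.single j (vertexGen n (f j)) : ProjSum n f) = z := by
  conv_rhs => rw [← Finset.univ_sum_single z]
  refine Finset.sum_congr rfl fun j _ => ?_
  rw [← Pi.single_smul, smul_vertexGen]

/-- The generator at the vertex `v` of `⨁ D e_j` (zero for `v = n`). -/
noncomputable def coverGen (n v : ℕ) : ProjSum n (fun j => j) :=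
  fun j => if (j : ℕ) = v then vertexGen n j else 0

theorem coverGen_eq_single (v : Fin n) :
    coverGen n v = Pi.single v (vertexGen n v) := by
  funext j
  by_cases h : j = v
  · subst h; simp [coverGen]
  · rw [Pi.single_eq_of_ne h, coverGen, if_neg fun h' => h (Fin.ext h')]

theorem coe_coverGen (v : ℕ) (j : Fin n) :
    (coverGen n v j : AuslanderAlg n) = if (j : ℕ) = v then e n v else 0 := by
  rw [coverGen]
  split_ifs with h
  · rw [← h]; rfl
  · rfl

theorem e_smul_coverGen (v : ℕ) : e n v • coverGen n v = coverGen n v := by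
  funext j
  apply Subtype.ext
  change e n v * (coverGen n v j : AuslanderAlg n) = _
  rw [coe_coverGen]
  split_ifs <;> simp [e_mul]

theorem coverGen_self : coverGen n n = 0 := by
  rw [← e_smul_coverGen, e_out le_rfl, zero_smul]

variable (I : Finset ℕ)

/-- The vertices of the relations between the generators of `M_I`. -/
def relVertex (n : ℕ) (r : Fin n) : ℕ := if (r : ℕ) + 1 ∈ I then r + 1 else r

/-- The relations between the generators of `M_I`. -/
noncomputable def relElt (n : ℕ) (r : Fin n) : ProjSum n (fun j => j) :=
  if (r : ℕ) + 1 ∈ I then b n (r + 1) • coverGen n r - coverGen n (r + 1)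
  else a n (r + 1) • coverGen n (r + 1) - coverGen n r

theorem coe_relElt (r j : Fin n) : (relElt I n r j : AuslanderAlg n) =
    if (r : ℕ) + 1 ∈ I then
      b n (r + 1) * (if j = r then e n r else 0) - (if (j : ℕ) = r + 1 then e n (r + 1) else 0)
    else a n (r + 1) * (if (j : ℕ) = r + 1 then e n (r + 1) else 0) -
      (if j = r then e n r else 0) := by
  rw [relElt]
  split_ifs <;> simp_all [coe_coverGen, Fin.ext_iff]

theorem e_smul_relElt (r : Fin n) : e n (relVertex I n r) • relElt I n r = relElt I n r := by
  rw [relElt, relVertex]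
  split_ifs
  · rw [smul_sub, ← mul_smul, e_mul_b, e_smul_coverGen]
  · have := e_mul_a (n := n) (r + 1)
    rw [Nat.add_sub_cancel] at this
    rw [smul_sub, ← mul_smul, this, e_smul_coverGen]

/-- The first map of the projective resolution of `M_I`. -/
noncomputable def relMap (n : ℕ) :
    ProjSum n (relVertex I n) →ₗ[AuslanderAlg n] ProjSum n (fun j => j) :=
  projLift (relElt I n)

/-- The projective cover map `⨁ D e_j → M_I`. -/
noncomputable def coverMap (n : ℕ) : ProjSum n (fun j => j) →ₗ[AuslanderAlg n] rankOne n I :=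
  projLift fun j => gen n I j

theorem coe_relMap_apply (z : ProjSum n (relVertex I n)) (j : Fin n) :
    (relMap I n z j : AuslanderAlg n) =
      ∑ r, (z r : AuslanderAlg n) * (relElt I n r j : AuslanderAlg n) := by
  rw [relMap, projLift_apply, Finset.sum_apply, AddSubmonoidClass.coe_finsetSum]
  rfl

/-- The relation matrix is triangular: relation r involves only the generators r and r + 1. Its
diagonal entry is b_{r+1} or -e_r, and right multiplication by it is injective on the r-th summand.
-/
theorem relMap_injective : Function.Injective (relMap I n) := by
  rw [injective_iff_map_eq_zero]
  intro z hz
  suffices h : ∀ k, ∀ r : Fin n, (r : ℕ) = k → z r = 0 from funext fun r => h r r rfl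
  intro k
  induction k using Nat.strong_induction_on with
  | _ k ih =>
    rintro r rfl
    have h1 := coe_relMap_apply I z r
    rw [hz, Finset.sum_eq_single r] at h1
    · have h2 : (z r : AuslanderAlg n) ∈ vertexProj n (if (r : ℕ) + 1 ∈ I then r + 1 else r) :=
        (z r).2
      rw [coe_relElt] at h1
      apply Subtype.ext
      by_cases hI : (r : ℕ) + 1 ∈ I
      · simp only [hI, if_true] at h1 h2
        have hb := b_mul_e (n := n) (r + 1)
        rw [Nat.add_sub_cancel] at hb
        rw [if_neg (by omega), sub_zero, hb] at h1
        exact mul_b_injective h2 h1.symm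
      · simp only [hI, if_false, if_true] at h1 h2
        rw [if_neg (by omega), mul_zero, zero_sub, mul_neg, mul_e_of_mem h2] at h1
        exact neg_eq_zero.1 h1.symm
    · intro s _ hs
      rcases lt_or_gt_of_ne hs with hlt | hlt
      · rw [ih s hlt s rfl]; simp
      · have hlt : (r : ℕ) < s := hlt
        have h0 : (relElt I n s r : AuslanderAlg n) = 0 := by
          rw [coe_relElt, if_neg (show ¬ r = s from fun h => hs h.symm),
            if_neg (show ¬ (r : ℕ) = s + 1 by omega)]
          simp
        rw [h0, mul_zero]
    · simp

theorem coverMap_coverGen {v : ℕ} (hv : v ≤ n) : coverMap I n (coverGen n v) = gen n I v := by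
  rcases hv.lt_or_eq with hv | rfl
  · rw [coverGen_eq_single ⟨v, hv⟩, coverMap, projLift_single]
    exact e_smul_gen I v
  · rw [coverGen_self, map_zero]
    exact Subtype.ext (g_eq_zero (by omega)).symm

theorem isRankOneFamily_gen : IsRankOneFamily (n := n) I (gen n I) where
  e_smul v _ := e_smul_gen I v
  b_smul v hv hI := Subtype.ext <| by
    change b n (v + 1) * g n v _ = g n (v + 1) _
    rw [b_mul_g, if_pos rfl, gap_succ I hv, if_pos hI, zero_add]
  a_smul v hv hI := Subtype.ext <| by
    change a n (v + 1) * g n (v + 1) _ = g n v _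
    rw [a_mul_g, if_pos ⟨rfl, by omega⟩, gap_succ I hv, if_neg hI, Nat.add_sub_cancel, add_comm]

theorem coverMap_relElt (r : Fin n) : coverMap I n (relElt I n r) = 0 := by
  have h := isRankOneFamily_gen (n := n) I
  rw [relElt]
  split_ifs with hI
  · rw [map_sub, map_smul, coverMap_coverGen I r.2.le, coverMap_coverGen I r.2,
      h.b_smul r r.2 hI, sub_self]
  · rw [map_sub, map_smul, coverMap_coverGen I r.2.le, coverMap_coverGen I r.2,
      h.a_smul r r.2 hI, sub_self]

theorem coverMap_surjective : Function.Surjective (coverMap I n) := by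
  rw [← LinearMap.range_eq_top, ← top_le_iff, ← span_gen, Submodule.span_le]
  rintro _ ⟨j, rfl⟩
  exact ⟨_, coverMap_coverGen I j.2.le⟩

theorem span_coverGen :
    Submodule.span (AuslanderAlg n) (Set.range fun j : Fin n => coverGen n j) = ⊤ := by
  rw [eq_top_iff]
  intro z _
  rw [← sum_smul_single z]
  refine Submodule.sum_mem _ fun j _ => Submodule.smul_mem _ _ (Submodule.subset_span ⟨j, ?_⟩)
  exact coverGen_eq_single j

theorem relElt_mem_range (r : Fin n) : relElt I n r ∈ LinearMap.range (relMap I n) :=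
  ⟨Pi.single r (vertexGen n _), by rw [relMap, projLift_single, e_smul_relElt]⟩

/-- Modulo the relations, the generators form a generating rank one family. Hence the cokernel of
the relation map embeds in D via the cover map, and no further relations exist. -/
theorem ker_coverMap : LinearMap.ker (coverMap I n) = LinearMap.range (relMap I n) := by
  have hle : LinearMap.range (relMap I n) ≤ LinearMap.ker (coverMap I n) := by
    rintro _ ⟨z, rfl⟩
    rw [LinearMap.mem_ker, relMap, projLift_apply, map_sum]
    exact Finset.sum_eq_zero fun r _ => by rw [map_smul, coverMap_relElt, smul_zero]
  refine le_antisymm ?_ hle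
  let R := LinearMap.range (relMap I n)
  have hfam : IsRankOneFamily (n := n) I fun v => R.mkQ (coverGen n v) :=
    { e_smul := fun v _ => by rw [← map_smul, e_smul_coverGen]
      b_smul := fun v hv hI => by
        have h := relElt_mem_range I ⟨v, hv⟩
        rw [relElt, if_pos hI] at h
        rw [← map_smul, ← sub_eq_zero, ← map_sub]
        exact (Submodule.Quotient.mk_eq_zero R).2 h
      a_smul := fun v hv hI => by
        have h := relElt_mem_range I ⟨v, hv⟩
        rw [relElt, if_neg hI] at h
        rw [← map_smul, ← sub_eq_zero, ← map_sub]
        exact (Submodule.Quotient.mk_eq_zero R).2 h }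
  have hinj := hfam.injective (by
      rw [Set.range_comp' R.mkQ, ← Submodule.map_span, span_coverGen, Submodule.map_top,
        Submodule.range_mkQ])
    ((rankOne n I).subtype ∘ₗ R.liftQ (coverMap I n) hle) (fun v hv => by
      change (coverMap I n (coverGen n v) : AuslanderAlg n) = _
      rw [coverMap_coverGen I hv.le]; rfl)
  intro z hz
  apply (Submodule.Quotient.mk_eq_zero R).1
  apply hinj
  rw [map_zero]
  exact congrArg Subtype.val (LinearMap.mem_ker.1 hz)

end Resolution

end AuslanderAlg

namespace AuslanderAlg

/-! ### The Euler characteristic and Ext¹ -/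

section Ext

variable {n : ℕ}

/-- The complex vector space `e_v M_J`. -/
noncomputable def vertexSpace (n : ℕ) (J : Finset ℕ) (v : ℕ) : Submodule ℂ (AuslanderAlg n) :=
  Submodule.span ℂ (Set.range fun i : Fin (n - v - gap n J v) => g n v (gap n J v + i))

theorem mem_vertexSpace {J : Finset ℕ} {v : ℕ} {x : AuslanderAlg n} :
    x ∈ vertexSpace n J v ↔ x ∈ rankOne n J ∧ e n v * x = x := by
  constructor
  · intro h
    induction h using Submodule.span_induction with
    | zero => simp
    | add x y _ _ hx hy => exact ⟨add_mem hx.1 hy.1, by rw [mul_add, hx.2, hy.2]⟩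
    | smul r x _ hx =>
      exact ⟨Submodule.smul_of_tower_mem _ r hx.1, by rw [mul_smul_comm, hx.2]⟩
    | mem x hx =>
      obtain ⟨i, rfl⟩ := hx
      exact ⟨g_mem_rankOne J (by omega), by rw [e_mul_g, if_pos rfl]⟩
  · rintro ⟨hx, he⟩
    rw [← sum_coord hx]
    refine Submodule.sum_mem _ fun p _ => ?_
    by_cases hp : p.1.1 = v
    · by_cases hk : p.1.2 < gap n J p.1.1
      · rw [coord_eq_zero hx hk, zero_smul]; exact zero_mem _
      · have := p.2
        refine Submodule.smul_mem _ _ (Submodule.subset_span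
          ⟨⟨p.1.2 - gap n J v, by subst hp; omega⟩, ?_⟩)
        subst hp
        simp only
        congr 1; omega
    · rw [coord_eq_zero_of_e_mul hx he hp, zero_smul]; exact zero_mem _

theorem linearIndependent_vertexSpace (J : Finset ℕ) (v : ℕ) :
    LinearIndependent ℂ fun i : Fin (n - v - gap n J v) => g n v (gap n J v + i) :=
  (linearIndependent_g n).comp
    (fun i : Fin (n - v - gap n J v) => (⟨(v, gap n J v + i), by simp only; omega⟩ : Tri n))
    fun i j hij => by
      simp only [Subtype.mk.injEq, Prod.mk.injEq] at hij
      exact Fin.ext (by omega)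

variable {f : Fin n → ℕ} {J : Finset ℕ}

theorem hom_single_mem (φ : ProjSum n f →ₗ[AuslanderAlg n] rankOne n J) (j : Fin n) :
    (φ (Pi.single j (vertexGen n (f j))) : AuslanderAlg n) ∈ vertexSpace n J (f j) := by
  refine mem_vertexSpace.2 ⟨(φ _).2, ?_⟩
  change ((e n (f j) • φ (Pi.single j (vertexGen n (f j))) : rankOne n J) : AuslanderAlg n) = _
  rw [← map_smul, ← Pi.single_smul]
  congr 3
  exact smul_vertexGen (vertexGen n (f j))

/-- The evaluation `Hom(⨁ D e_{f j}, M_J) → ∏ e_{f j} M_J`. -/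
noncomputable def evalProj (n : ℕ) (f : Fin n → ℕ) (J : Finset ℕ) :
    (ModuleCat.of (AuslanderAlg n) (ProjSum n f) ⟶ rankOneMod n J) →ₗ[ℂ]
      ((j : Fin n) → vertexSpace n J (f j)) where
  toFun φ j := ⟨_, hom_single_mem φ.hom j⟩
  map_add' _ _ := rfl
  map_smul' r φ := by
    funext j
    apply Subtype.ext
    rw [RingHom.id_apply, Pi.smul_apply, Submodule.coe_smul, Algebra.smul_def]; rfl

theorem evalProj_bijective : Function.Bijective (evalProj n f J) := by
  constructor
  · rw [injective_iff_map_eq_zero]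
    intro φ hφ
    apply ModuleCat.hom_ext
    refine LinearMap.ext fun z : ProjSum n f => ?_
    change φ.hom z = 0
    rw [← sum_smul_single z, map_sum]
    refine Finset.sum_eq_zero fun j _ => ?_
    have h : φ.hom (Pi.single j (vertexGen n (f j))) = 0 :=
      Subtype.ext (by have := congrArg Subtype.val (congrFun hφ j); exact this)
    rw [map_smul, h, smul_zero]
  · intro y
    have hy := fun j => mem_vertexSpace.1 (y j).2
    refine ⟨ModuleCat.ofHom (projLift fun j => (⟨y j, (hy j).1⟩ : rankOne n J)), ?_⟩
    funext j
    apply Subtype.ext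
    change ((projLift (fun j => (⟨y j, (hy j).1⟩ : rankOne n J))
      (Pi.single j (vertexGen n (f j)) : ProjSum n f) : rankOne n J) : AuslanderAlg n) = _
    rw [projLift_single]
    exact (hy j).2

/-- Hom(D e_v, M_J) is e_v M_J, with one basis vector for each exponent from `gap n J v` to n - v -
1. -/
theorem rank_hom_projSum (f : Fin n → ℕ) (J : Finset ℕ) :
    Module.rank ℂ (ModuleCat.of (AuslanderAlg n) (ProjSum n f) ⟶ rankOneMod n J) =
      ((∑ j, (n - f j - gap n J (f j)) : ℕ) : Cardinal) := by
  let B : (j : Fin n) → Module.Basis (Fin (n - f j - gap n J (f j))) ℂ (vertexSpace n J (f j)) :=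
    fun j => Module.Basis.span (linearIndependent_vertexSpace J (f j))
  rw [(LinearEquiv.ofBijective _ (evalProj_bijective (f := f) (J := J))).rank_eq,
    rank_eq_card_basis (Pi.basis B), Fintype.card_sigma]
  simp only [Fintype.card_fin]

/-- Passing from e_r M_J to e_{r+1} M_J lowers the dimension by one if r + 1 ∈ J and by zero
otherwise. The relation r sits at r + 1 instead of r exactly when r + 1 ∈ I. -/
theorem sum_relVertex (I J : Finset ℕ) (hI : I ⊆ Finset.Icc 1 n) :
    ∑ r : Fin n, (n - r - gap n J r) =
      ∑ r : Fin n, (n - relVertex I n r - gap n J (relVertex I n r)) + #(I ∩ J) := by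
  have hc : #(I ∩ J) = ∑ r : Fin n, if (r : ℕ) + 1 ∈ I ∩ J then 1 else 0 := by
    rw [Fin.sum_univ_eq_sum_range (fun r => if r + 1 ∈ I ∩ J then 1 else 0) n,
      ← Finset.card_filter]
    symm
    apply Finset.card_bij (fun r _ => r + 1)
    · intro r hr; exact (Finset.mem_filter.1 hr).2
    · intro r _ s _ h; omega
    · intro i hi
      have := Finset.mem_Icc.1 (hI (Finset.mem_inter.1 hi).1)
      refine ⟨i - 1, ?_, by omega⟩
      rw [Finset.mem_filter, Finset.mem_range, Nat.sub_add_cancel this.1]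
      exact ⟨by omega, hi⟩
  rw [hc, ← Finset.sum_add_distrib]
  refine Finset.sum_congr rfl fun r _ => ?_
  have h1 := gap_succ (n := n) J r.2
  have h2 := gap_le (n := n) J (j := r + 1) r.2
  rw [relVertex]
  by_cases hrI : (r : ℕ) + 1 ∈ I <;> by_cases hrJ : (r : ℕ) + 1 ∈ J <;>
    simp only [hrI, hrJ, Finset.mem_inter, if_true, if_false, and_true, and_false] at h1 ⊢ <;>
    omega

open CategoryTheory Abelian in
theorem rank_ext {I J : Finset ℕ} (hI : I ⊆ Finset.Icc 1 n) {c : ℕ}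
    (hc : Module.rank ℂ (rankOneMod n I ⟶ rankOneMod n J) = ((#(I ∩ J) + c : ℕ) : Cardinal)) :
    Module.rank ℂ (Ext (rankOneMod n I) (rankOneMod n J) 1) = (c : Cardinal) := by
  let S : ShortComplex (ModuleCat.{0} (AuslanderAlg n)) :=
    ShortComplex.mk (ModuleCat.ofHom (relMap I n)) (ModuleCat.ofHom (coverMap I n)) (by
      ext1
      exact LinearMap.range_le_ker_iff.1 (ker_coverMap I).ge)
  have hS : S.ShortExact :=
    { exact := (ShortComplex.moduleCat_exact_iff_range_eq_ker _).2 (ker_coverMap I).symm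
      mono_f := (ModuleCat.mono_iff_injective _).2 (relMap_injective I)
      epi_g := (ModuleCat.epi_iff_surjective _).2 (coverMap_surjective I) }
  have : Module.Projective (AuslanderAlg n) (ProjSum n fun j => j) :=
    Module.Projective.of_equiv (DirectSum.linearEquivFunOnFintype (AuslanderAlg n) (Fin n)
      fun j => vertexProj n j)
  have : Projective S.X₂ := (IsProjective.iff_projective _).1 this
  have h := rank_ext_one_add_rank_hom (k := ℂ) hS (rankOneMod n J)
  change Module.rank ℂ (Ext (rankOneMod n I) (rankOneMod n J) 1) +
    Module.rank ℂ (ModuleCat.of (AuslanderAlg n) (ProjSum n fun j => j) ⟶ rankOneMod n J) =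
    Module.rank ℂ (ModuleCat.of (AuslanderAlg n) (ProjSum n (relVertex I n)) ⟶ rankOneMod n J) +
    Module.rank ℂ (rankOneMod n I ⟶ rankOneMod n J) at h
  rw [rank_hom_projSum, rank_hom_projSum, hc, sum_relVertex I J hI, ← Nat.cast_add,
    ← add_assoc, Nat.cast_add _ c, add_comm _ (c : Cardinal)] at h
  -- After `sum_relVertex`, both sides contain the same finite dimension of Hom from the middle
  -- term, which cancels.
  exact (Cardinal.add_nat_inj _).1 h

end Ext

/-! ### Extremal gap differences for weakly separated sets -/

section WeakSeparation

variable {n : ℕ} {I J J' J'' : Finset ℕ}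

/-- Both sides count the elements of {j + 1, …, n} outside I ∩ J. -/
theorem gap_add_card_sdiff (I J : Finset ℕ) (j : ℕ) :
    gap n J j + #((J \ I) ∩ Finset.Icc (j + 1) n) =
      gap n I j + #((I \ J) ∩ Finset.Icc (j + 1) n) := by
  rw [gap, gap, ← Finset.card_union_of_disjoint, ← Finset.card_union_of_disjoint]
  · congr 1
    ext x
    simp only [Finset.mem_union, Finset.mem_sdiff, Finset.mem_inter]
    tauto
  all_goals
    rw [Finset.disjoint_left]
    intro x
    simp only [Finset.mem_sdiff, Finset.mem_inter]
    tauto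

/-- A common element x of J' and J'' makes J \ I nonempty, hence I \ J too by cardinality. Any y ∈ I
\ J then satisfies x < y < x. -/
theorem isSeparation_of_union (hcard : #J ≤ #I) (hunion : J \ I = J' ∪ J'')
    (hlt' : SetLT J' (I \ J)) (hlt'' : SetLT (I \ J) J'') : IsSeparation I J J' J'' := by
  refine ⟨hcard, hunion, ?_, hlt', hlt''⟩
  rw [Finset.disjoint_left]
  intro x hx hx''
  have hle := Finset.card_sdiff_le_card_sdiff_iff.2 hcard
  have hpos : 0 < #(J \ I) := Finset.card_pos.2 ⟨x, hunion ▸ Finset.mem_union_left _ hx⟩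
  obtain ⟨y, hy⟩ := Finset.card_pos.1 (hpos.trans_le hle)
  exact lt_asymm (hlt' x hx y hy) (hlt'' y hy x hx'')

theorem rank_hom_of_isSeparation (hI : I ⊆ Finset.Icc 1 n) (hJ : J ⊆ Finset.Icc 1 n)
    (h : IsSeparation I J J' J'') :
    Module.rank ℂ (rankOneMod n I ⟶ rankOneMod n J) = ((#(I ∩ J) + #J'' : ℕ) : Cardinal) ∧
    Module.rank ℂ (rankOneMod n J ⟶ rankOneMod n I) = ((#(I ∩ J) + #J' : ℕ) : Cardinal) := by
  obtain ⟨hcard, hunion, hdisj, hlt', hlt''⟩ := h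
  have hle : #(J \ I) ≤ #(I \ J) := Finset.card_sdiff_le_card_sdiff_iff.2 hcard
  have hsum : #(J \ I) = #J' + #J'' := by rw [hunion, Finset.card_union_of_disjoint hdisj]
  have hcI := Finset.card_inter_add_card_sdiff I J
  have hcJ := Finset.card_inter_add_card_sdiff J I
  rw [Finset.inter_comm] at hcJ
  have hB : ∀ x ∈ J \ I, 1 ≤ x ∧ x ≤ n := fun x hx =>
    Finset.mem_Icc.1 (hJ (Finset.mem_sdiff.1 hx).1)
  have hA : ∀ x ∈ I \ J, 1 ≤ x ∧ x ≤ n := fun x hx =>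
    Finset.mem_Icc.1 (hI (Finset.mem_sdiff.1 hx).1)
  have hJ'' : J'' ⊆ J \ I := hunion ▸ Finset.subset_union_right
  have hJ' : J' ⊆ J \ I := hunion ▸ Finset.subset_union_left
  have hgap := fun j => gap_add_card_sdiff (n := n) I J j
  constructor
  · have bound : ∀ j ≤ n, gap n J j ≤ gap n I j + (#(I \ J) - #J'') := by
      intro j _
      have hg := hgap j
      by_cases hsub : J'' ⊆ Finset.Icc (j + 1) n
      · have h1 := Finset.card_le_card (Finset.subset_inter hJ'' hsub)
        have h2 : #((I \ J) ∩ Finset.Icc (j + 1) n) ≤ #(I \ J) :=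
          Finset.card_le_card Finset.inter_subset_left
        omega
      -- Some y ∈ J'' is at most j, so all of I \ J lies below j and contributes nothing.
      · obtain ⟨y, hy, hyj⟩ := Finset.not_subset.1 hsub
        have hyn := hB y (hJ'' hy)
        rw [Finset.mem_Icc] at hyj
        have h0 : (I \ J) ∩ Finset.Icc (j + 1) n = ∅ := by
          rw [Finset.eq_empty_iff_forall_notMem]
          intro x hx
          rw [Finset.mem_inter, Finset.mem_Icc] at hx
          have := hlt'' x hx.1 y hy
          omega
        rw [h0, Finset.card_empty] at hg
        omega
    -- The maximum is attained just before the least element of I \ J: beyond that point lie all of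
    -- I \ J and, from J \ I, exactly J''.
    obtain ⟨v, hv, heq⟩ : ∃ v ≤ n, gap n J v = gap n I v + (#(I \ J) - #J'') := by
      rcases (I \ J).eq_empty_or_nonempty with h0 | hne
      · refine ⟨n, le_rfl, ?_⟩
        rw [gap_self, gap_self, h0, Finset.card_empty]; omega
      · have hmin := Finset.min'_mem _ hne
        have hmn := hA _ hmin
        set w := (I \ J).min' hne
        refine ⟨w - 1, by omega, ?_⟩
        have hg := hgap (w - 1)
        rw [Nat.sub_add_cancel hmn.1] at hg
        have h1 : (I \ J) ∩ Finset.Icc w n = I \ J := by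
          rw [Finset.inter_eq_left]
          intro x hx
          exact Finset.mem_Icc.2 ⟨Finset.min'_le _ _ hx, (hA x hx).2⟩
        have h2 : (J \ I) ∩ Finset.Icc w n = J'' := by
          ext x
          rw [Finset.mem_inter, Finset.mem_Icc]
          constructor
          · rintro ⟨hx, hxw, -⟩
            rw [hunion, Finset.mem_union] at hx
            rcases hx with hx | hx
            · have := hlt' x hx w hmin
              omega
            · exact hx
          · intro hx
            exact ⟨hJ'' hx, (hlt'' w hmin x hx).le, (hB x (hJ'' hx)).2⟩
        rw [h1, h2] at hg
        omega
    rw [rank_hom hI bound hv heq]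
    congr 1; omega
  · have bound : ∀ j ≤ n, gap n I j ≤ gap n J j + #J'' := by
      intro j _
      have hg := hgap j
      by_cases hsub : I \ J ⊆ Finset.Icc (j + 1) n
      · rw [Finset.inter_eq_left.2 hsub] at hg
        have h2 : #((J \ I) ∩ Finset.Icc (j + 1) n) ≤ #(J \ I) :=
          Finset.card_le_card Finset.inter_subset_left
        omega
      · obtain ⟨y, hy, hyj⟩ := Finset.not_subset.1 hsub
        have hyn := hA y hy
        rw [Finset.mem_Icc] at hyj
        have h0 : (J \ I) ∩ Finset.Icc (j + 1) n ⊆ J'' := by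
          intro x hx
          rw [Finset.mem_inter, Finset.mem_Icc, hunion, Finset.mem_union] at hx
          rcases hx.1 with hx' | hx'
          · have := hlt' x hx' y hy
            omega
          · exact hx'
        have := Finset.card_le_card h0
        omega
    -- The opposite difference is largest at the greatest element of I \ J, beyond which only J''
    -- remains. If I \ J is empty, so is J \ I by cardinality, and v = n works.
    obtain ⟨v, hv, heq⟩ : ∃ v ≤ n, gap n I v = gap n J v + #J'' := by
      rcases (I \ J).eq_empty_or_nonempty with h0 | hne
      · refine ⟨n, le_rfl, ?_⟩
        rw [h0, Finset.card_empty] at hle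
        rw [gap_self, gap_self]; omega
      · have hmax := Finset.max'_mem _ hne
        have hmn := hA _ hmax
        set w := (I \ J).max' hne
        refine ⟨w, hmn.2, ?_⟩
        have hg := hgap w
        have h1 : (I \ J) ∩ Finset.Icc (w + 1) n = ∅ := by
          rw [Finset.eq_empty_iff_forall_notMem]
          intro x hx
          rw [Finset.mem_inter, Finset.mem_Icc] at hx
          have : x ≤ w := Finset.le_max' _ _ hx.1
          omega
        have h2 : (J \ I) ∩ Finset.Icc (w + 1) n = J'' := by
          ext x
          rw [Finset.mem_inter, Finset.mem_Icc]
          constructor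
          · rintro ⟨hx, hxw, -⟩
            rw [hunion, Finset.mem_union] at hx
            rcases hx with hx | hx
            · have := hlt' x hx w hmax
              omega
            · exact hx
          · intro hx
            exact ⟨hJ'' hx, hlt'' w hmax x hx, (hB x (hJ'' hx)).2⟩
        rw [h1, h2, Finset.card_empty] at hg
        omega
    rw [rank_hom hJ bound hv heq]
    congr 1; omega

end WeakSeparation

end AuslanderAlg

-- The pair picked by choice need not be identified with (J', J''): the Hom dimensions determine the
-- cardinalities of both parts of any separation.
open AuslanderAlg in
theorem lzExponent_eq {n : ℕ} {I J J' J'' : Finset ℕ} (hI : I ⊆ Finset.Icc 1 n)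
    (hJ : J ⊆ Finset.Icc 1 n) (h : IsSeparation I J J' J'') :
    lzExponent I J = (#J'' : ℤ) - #J' := by
  have hex : ∃ p : Finset ℕ × Finset ℕ, IsSeparation I J p.1 p.2 := ⟨(J', J''), h⟩
  rw [lzExponent, dif_pos hex]
  have h1 := rank_hom_of_isSeparation hI hJ h
  have h2 := rank_hom_of_isSeparation hI hJ hex.choose_spec
  have h3 := Nat.cast_injective (h1.1.symm.trans h2.1)
  have h4 := Nat.cast_injective (h1.2.symm.trans h2.2)
  omega
theorem mainTheorem8 (n : ℕ) (hn : 1 < n) (I J J' J'' : Finset ℕ)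
    (hI : I ⊆ Finset.Icc 1 n) (hJ : J ⊆ Finset.Icc 1 n)
    (hIJ : WeaklySeparated I J) (hcard : #J ≤ #I) (hunion : J \ I = J' ∪ J'')
    (hlt' : SetLT J' (I \ J)) (hlt'' : SetLT (I \ J) J'') :
    Module.rank ℂ (AuslanderAlg.rankOneMod n I ⟶ AuslanderAlg.rankOneMod n J) =
        ((#(I ∩ J) + #J'' : ℕ) : Cardinal) ∧
    Module.rank ℂ (AuslanderAlg.rankOneMod n J ⟶ AuslanderAlg.rankOneMod n I) =
        ((#(I ∩ J) + #J' : ℕ) : Cardinal) ∧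
    Module.rank ℂ (CategoryTheory.Abelian.Ext
        (AuslanderAlg.rankOneMod n I) (AuslanderAlg.rankOneMod n J) 1) = (#J'' : Cardinal) ∧
    Module.rank ℂ (CategoryTheory.Abelian.Ext
        (AuslanderAlg.rankOneMod n J) (AuslanderAlg.rankOneMod n I) 1) = (#J' : Cardinal) ∧
    lzExponent I J =
      (Module.finrank ℂ (AuslanderAlg.rankOneMod n I ⟶ AuslanderAlg.rankOneMod n J) : ℤ) -
        Module.finrank ℂ (AuslanderAlg.rankOneMod n J ⟶ AuslanderAlg.rankOneMod n I) ∧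
    lzExponent I J =
      (Module.finrank ℂ (CategoryTheory.Abelian.Ext
        (AuslanderAlg.rankOneMod n I) (AuslanderAlg.rankOneMod n J) 1) : ℤ) -
        Module.finrank ℂ (CategoryTheory.Abelian.Ext
          (AuslanderAlg.rankOneMod n J) (AuslanderAlg.rankOneMod n I) 1) := by
  have hsep := AuslanderAlg.isSeparation_of_union hcard hunion hlt' hlt''
  obtain ⟨h1, h2⟩ := AuslanderAlg.rank_hom_of_isSeparation hI hJ hsep
  have h3 := AuslanderAlg.rank_ext hI h1
  have h4 := AuslanderAlg.rank_ext hJ (Finset.inter_comm I J ▸ h2)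
  refine ⟨h1, h2, h3, h4, ?_, ?_⟩
  · rw [lzExponent_eq hI hJ hsep, Module.finrank_eq_of_rank_eq h1, Module.finrank_eq_of_rank_eq h2]
    push_cast
    ring
  · rw [lzExponent_eq hI hJ hsep, Module.finrank_eq_of_rank_eq h3, Module.finrank_eq_of_rank_eq h4]
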